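/- Let $n\ge 0$ be even and $d\ge 1$. Denote by $0$ the point of the vector space $\mathbb C[x_0,\dots,x_{n+1}]_d$ of homogeneous polynomials of degree $d$ given by the Fermat polynomial $x_0^d+\cdots+x_{n+1}^d$, let $X^d_n\subset\mathbb P^{n+1}$ be the Fermat variety defined by it, and let $\mathsf T\subset\mathbb C[x_0,\dots,x_{n+1}]_d$ be the open set of polynomials defining smooth hypersurfaces. A linear cycle in $X^d_n$ is a linear subspace $$\mathbb P^{\frac n2}_{a,b}:\quad x_{b_{2e}}-\zeta_{2d}^{1+2a_{2e+1}}x_{b_{2e+1}}=0,\qquad e=0,\dots,\tfrac n2,$$ where $\zeta_{2d}=e^{2\pi\sqrt{-1}/(2d)}$, $a_1,a_3,\dots,a_{n+1}\in\{0,\dots,d-1\}$ and $b$ is a permutation of $\{0,\dots,n+1\}$. For a linear cycle $\mathbb P^{\frac n2}$ let $V_{\mathbb P^{n/2}}\subset(\mathsf T,0)$ be the local branch parameterizing deformations of the pair $\mathbb P^{\frac n2}\subset X^d_n$, i.e. the germ at $0$ of the set of $t\in\mathsf T$ such that the hypersurface $X_t$ contains a linear $\mathbb P^{\frac n2}_t$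 close to $\mathbb P^{\frac n2}$ (this germ is well defined: it is the same for all sufficiently small neighbourhoods of $\mathbb P^{\frac n2}$ in the Grassmannian). For a finite sequence $\underline a=(a_1,\dots,a_s)$ of natural numbers put $$\mathsf C_{\underline a}=\binom{n+1+d}{n+1}-\sum_{k=1}^{s}(-1)^{k-1}\sum_{a_{i_1}+\cdots+a_{i_k}\le d}\binom{n+1+d-a_{i_1}-\cdots-a_{i_k}}{n+1},$$ the inner sum being over the $k$-element sets $\{i_1,\dots,i_k\}\subset\{1,\dots,s\}$ with $a_{i_1}+\cdots+a_{i_k}\le d$, and write $1^p,(d-1)^q$ for the sequence of $p$ ones followed by $q$ copies of $d-1$. Let $\mathbb P^{\frac n2},\check{\mathbb P}^{\frac n2}$ be two linear cycles in $X^d_n$ with $\mathbb P^{\frac n2}\cap\check{\mathbb P}^{\frac n2}=\mathbb P^m$, $-1\le m\le\frac n2$ (where $\mathbb P^{-1}=\emptyset$). Then the codimension in $\mathsf T$ at $0$ of the intersection of the two local branches is $$\operatorname{codim}\bigl(V_{\mathbb P^{n/2}}\cap V_{\check{\mathbb P}^{n/2}}\bigr)=2\,\mathsf C_{1^{\frac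 n2+1},(d-1)^{\frac n2+1}}-\mathsf C_{1^{n-m+1},(d-1)^{m+1}}.$$ In particular, if $\mathbb P^{\frac n2}\cap\check{\mathbb P}^{\frac n2}=\emptyset$, then $V_{\mathbb P^{n/2}}$ and $V_{\check{\mathbb P}^{n/2}}$ are germs of complex submanifolds of $\mathsf T$ that intersect transversely at $0$. -/

import Mathlib

open Filter Topology

noncomputable section

/-! ### Homogeneous forms and smooth hypersurfaces -/

/-- Exponents of the monomials of degree `d` in `x_0, …, x_{N-1}`. -/
abbrev MonomialIndex (N d : ℕ) : Type :=
  ↥(Finset.piAntidiag (Finset.univ : Finset (Fin N)) d)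

/-- The complex vector space `ℂ[x_0, …, x_{N-1}]_d` of homogeneous polynomials of degree `d`,
a polynomial being given by the family of its coefficients (this carries the usual topology of
a finite-dimensional complex vector space). -/
abbrev Form (N d : ℕ) : Type := MonomialIndex N d → ℂ

/-- The polynomial with the given coefficients. -/
def Form.toPoly {N d : ℕ} (c : Form N d) : MvPolynomial (Fin N) ℂ :=
  ∑ i : MonomialIndex N d, MvPolynomial.monomial (Finsupp.equivFunOnFinite.symm i.1) (c i)

/-- The coefficients in degree `d` of a polynomial. -/
def Form.ofPoly {N : ℕ} (d : ℕ) (p : MvPolynomial (Fin N) ℂ) : Form N d :=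
  fun i => p.coeff (Finsupp.equivFunOnFinite.symm i.1)

/-- The Fermat polynomial `x_0^d + ⋯ + x_{N-1}^d`. -/
def fermat (N d : ℕ) : Form N d :=
  Form.ofPoly d (∑ j : Fin N, MvPolynomial.X j ^ d)

/-- The projective hypersurface `{c = 0}` is smooth: the partial derivatives of the form have no
common zero on it. -/
def Form.IsSmooth {N d : ℕ} (c : Form N d) : Prop :=
  ∀ x : Fin N → ℂ, x ≠ 0 → MvPolynomial.eval x c.toPoly = 0 →
    ∃ j : Fin N, MvPolynomial.eval x (MvPolynomial.pderiv j c.toPoly) ≠ 0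

/-! ### Grassmannians -/

/-- The Grassmannian of `r`-dimensional linear subspaces of `ℂ^N`, i.e. of linear
`ℙ^{r-1}`'s in `ℙ^{N-1}`. -/
def Gr (r N : ℕ) : Type :=
  {L : Submodule ℂ (Fin N → ℂ) // Module.finrank ℂ L = r}

/-- The space of `r`-frames in `ℂ^N`, with the topology of a subspace of `(ℂ^N)^r`. -/
abbrev Frame (r N : ℕ) : Type :=
  {v : Fin r → Fin N → ℂ // LinearIndependent ℂ v}

/-- The subspace spanned by a frame. -/
def Frame.toGr {r N : ℕ} (v : Frame r N) : Gr r N :=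
  ⟨Submodule.span ℂ (Set.range v.1), by
    rw [finrank_span_eq_card v.2, Fintype.card_fin]⟩

/-- The usual topology of the Grassmannian: the quotient topology of the space of frames. -/
instance Gr.instTopologicalSpace (r N : ℕ) : TopologicalSpace (Gr r N) :=
  TopologicalSpace.coinduced (Frame.toGr (r := r) (N := N)) inferInstance

/-! ### Linear cycles in the Fermat variety -/

/-- The subspace of `ℂ^{2k+2}` given by the equations
`x_{b_{2e}} - ζ_{2d}^{1 + 2 a_e} x_{b_{2e+1}} = 0`, `e = 0, …, k`, where
`ζ_{2d} = exp (2πi / (2d))`. -/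
def linearCycleSubmodule {k d : ℕ} (a : Fin (k + 1) → Fin d)
    (b : Equiv.Perm (Fin (2 * k + 2))) : Submodule ℂ (Fin (2 * k + 2) → ℂ) where
  carrier := {x | ∀ e : Fin (k + 1),
    x (b ⟨2 * e, by omega⟩) -
      Complex.exp (2 * Real.pi * Complex.I / (2 * d)) ^ (1 + 2 * (a e : ℕ)) *
        x (b ⟨2 * e + 1, by omega⟩) = 0}
  add_mem' := by
    intro x y hx hy e
    have h1 := hx e
    have h2 := hy e
    simp only [Pi.add_apply]
    linear_combination h1 + h2
  zero_mem' := by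
    intro e
    simp
  smul_mem' := by
    intro t x hx e
    have h1 := hx e
    simp only [Pi.smul_apply, smul_eq_mul]
    linear_combination t * h1

theorem finrank_linearCycleSubmodule {k d : ℕ} (a : Fin (k + 1) → Fin d)
    (b : Equiv.Perm (Fin (2 * k + 2))) :
    Module.finrank ℂ (linearCycleSubmodule a b) = k + 1 := by
  let z : Fin (k + 1) → ℂ := fun e =>
    Complex.exp (2 * Real.pi * Complex.I / (2 * d)) ^ (1 + 2 * (a e : ℕ))
  let F : (Fin (k + 1) → ℂ) → (Fin (2 * k + 2) → ℂ) := fun y i =>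
    if ((b.symm i : Fin (2 * k + 2)) : ℕ) % 2 = 0
    then z ⟨(b.symm i : ℕ) / 2, by omega⟩ * y ⟨(b.symm i : ℕ) / 2, by omega⟩
    else y ⟨(b.symm i : ℕ) / 2, by omega⟩
  have hF0 : ∀ y (e : Fin (k + 1)), F y (b ⟨2 * e, by omega⟩) = z e * y e := by
    intro y e
    simp [F]
  have hF1 : ∀ y (e : Fin (k + 1)), F y (b ⟨2 * e + 1, by omega⟩) = y e := by
    intro y e
    have h1 : (2 * (e : ℕ) + 1) / 2 = e := by omega
    simp [F, h1]
  let E : (linearCycleSubmodule a b) ≃ₗ[ℂ] (Fin (k + 1) → ℂ) :=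
    { toFun := fun x e => x.1 (b ⟨2 * e + 1, by omega⟩)
      map_add' := fun x y => rfl
      map_smul' := fun t x => rfl
      invFun := fun y => ⟨F y, fun e => by rw [hF0, hF1]; exact sub_self _⟩
      left_inv := by
        intro x
        apply Subtype.ext
        funext i
        obtain ⟨j, rfl⟩ := b.surjective i
        have hx := x.2
        rcases Nat.mod_two_eq_zero_or_one (j : ℕ) with h | h
        · obtain ⟨e, he⟩ : ∃ e : Fin (k + 1), j = ⟨2 * e, by omega⟩ :=
            ⟨⟨(j : ℕ) / 2, by omega⟩, Fin.ext (by simp only; omega)⟩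
          change F (fun e => x.1 (b ⟨2 * e + 1, by omega⟩)) (b j) = x.1 (b j)
          rw [he]
          exact (hF0 (fun e => x.1 (b ⟨2 * e + 1, by omega⟩)) e).trans (sub_eq_zero.mp (hx e)).symm
        · obtain ⟨e, he⟩ : ∃ e : Fin (k + 1), j = ⟨2 * e + 1, by omega⟩ :=
            ⟨⟨(j : ℕ) / 2, by omega⟩, Fin.ext (by simp only; omega)⟩
          change F (fun e => x.1 (b ⟨2 * e + 1, by omega⟩)) (b j) = x.1 (b j)
          rw [he]
          exact hF1 (fun e => x.1 (b ⟨2 * e + 1, by omega⟩)) e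
      right_inv := by
        intro y
        funext e
        exact hF1 y e }
  rw [E.finrank_eq]
  simp

/-- The linear cycle `ℙ^k_{a,b} ⊆ ℙ^{2k+1}`, as a point of the Grassmannian. -/
def linearCycle {k d : ℕ} (a : Fin (k + 1) → Fin d)
    (b : Equiv.Perm (Fin (2 * k + 2))) : Gr (k + 1) (2 * k + 2) :=
  ⟨linearCycleSubmodule a b, finrank_linearCycleSubmodule a b⟩

/-! ### The local branches -/

/-- The smooth hypersurfaces of degree `d` that contain some linear subspace from `S`. -/
def hypersurfacesContaining {r N : ℕ} (d : ℕ) (S : Set (Gr r N)) : Set (Form N d) :=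
  {c | c.IsSmooth ∧ ∃ L ∈ S, ∀ x ∈ L.1, MvPolynomial.eval x c.toPoly = 0}

/-- `V` represents the germ at `c₀` of the locus of the smooth hypersurfaces to which the pair
`(P, {c₀ = 0})` deforms: near `c₀`, the set `V` is the set of the hypersurfaces that contain a
linear subspace close to `P`, whatever sufficiently small neighbourhood of `P` is
used to say what close means. -/
def IsLocalBranch {r N d : ℕ} (P : Gr r N) (c₀ : Form N d) (V : Set (Form N d)) : Prop :=
  ∃ S₀ ∈ 𝓝 P, ∀ S ∈ 𝓝 P, S ⊆ S₀ → V =ᶠ[𝓝 c₀] hypersurfacesContaining d S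

/-- The local branch is unique as a germ. -/
theorem IsLocalBranch.unique {r N d : ℕ} {P : Gr r N} {c₀ : Form N d} {V W : Set (Form N d)}
    (hV : IsLocalBranch P c₀ V) (hW : IsLocalBranch P c₀ W) : V =ᶠ[𝓝 c₀] W := by
  obtain ⟨S, hS, h⟩ := hV
  obtain ⟨S', hS', h'⟩ := hW
  exact (h _ (inter_mem hS hS') Set.inter_subset_left).trans
    (h' _ (inter_mem hS hS') Set.inter_subset_right).symm

/-! ### Dimension and transversality of germs of analytic sets -/

section Germs

variable {E : Type*} [NormedAddCommGroup E] [NormedSpace ℂ E]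

/-- Arbitrarily close to `p`, the set `A` contains an `r`-dimensional complex manifold (the
image of an open subset of `ℂ^r` under a holomorphic immersion). -/
def ContainsManifoldsNear (A : Set E) (p : E) (r : ℕ) : Prop :=
  ∀ U ∈ 𝓝 p, ∃ (W : Set (Fin r → ℂ)) (φ : (Fin r → ℂ) → E),
    IsOpen W ∧ W.Nonempty ∧ AnalyticOnNhd ℂ φ W ∧
      (∀ w ∈ W, Function.Injective (fderiv ℂ φ w)) ∧ Set.MapsTo φ W (A ∩ U)

/-- The local dimension at `p` of the analytic set `A` is `r`. -/
def HasLocalDim (A : Set E) (p : E) (r : ℕ) : Prop :=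
  IsGreatest {s : ℕ | ContainsManifoldsNear A p s} r

/-- The local codimension at `p` of the analytic set `A` in the ambient space is `c`. -/
def HasLocalCodim (A : Set E) (p : E) (c : ℤ) : Prop :=
  ∃ r : ℕ, HasLocalDim A p r ∧ c = (Module.finrank ℂ E : ℤ) - r

/-- `A` is near `p ∈ A` a complex submanifold, with tangent space `T` at `p`. -/
def IsSubmanifoldAt (A : Set E) (p : E) (T : Submodule ℂ E) : Prop :=
  p ∈ A ∧ ∃ (c : ℕ) (g : E → Fin c → ℂ), AnalyticAt ℂ g p ∧
    Function.Surjective (fderiv ℂ g p) ∧ T = LinearMap.ker (fderiv ℂ g p).toLinearMap ∧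
    A =ᶠ[𝓝 p] {x | g x = 0}

/-- `A` and `B` are near `p` complex submanifolds that meet transversely at `p`. -/
def TransverseAt (A B : Set E) (p : E) : Prop :=
  ∃ T T' : Submodule ℂ E, IsSubmanifoldAt A p T ∧ IsSubmanifoldAt B p T' ∧ T ⊔ T' = ⊤

end Germs

/-! ### The numbers `C` -/

/-- `C_a = binom(n+1+d, n+1) - ∑_{j=1}^{s} (-1)^{j-1} ∑ binom(n+1+d-a_{i_1}-⋯-a_{i_j}, n+1)`,
the inner sum being over the sets of `j` indices with `a_{i_1}+⋯+a_{i_j} ≤ d`. -/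
def cNumber (n d : ℕ) {s : ℕ} (a : Fin s → ℕ) : ℤ :=
  ((n + 1 + d).choose (n + 1) : ℤ) -
    ∑ j ∈ Finset.Icc 1 s, (-1) ^ (j - 1) *
      ∑ I ∈ (Finset.powersetCard j (Finset.univ : Finset (Fin s))).filter
          (fun I => ∑ i ∈ I, a i ≤ d),
        ((n + 1 + d - ∑ i ∈ I, a i).choose (n + 1) : ℤ)

/-- The sequence `1^p, (d-1)^q`. -/
def onesThen (d p q : ℕ) : Fin (p + q) → ℕ :=
  Fin.append (fun _ : Fin p => 1) (fun _ : Fin q => d - 1)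

end

/-! Write `F` for the Fermat form, `L` and `L'` for the two linear cycles, `I(L)` for the degree `d`
forms vanishing on `L`, and `J` for the range of `fermatDeriv`: the degree `d` part of the Jacobian
ideal of `F`, tangent at `F` to its orbit under coordinate changes.

Linear cycles and their intersections are cut out by binomial equations, so they have bases with
disjoint supports (`exists_hasDisjointColumns`). In such a basis, moving a `q`-dimensional subspace
to first order changes the restriction of `F` exactly by combinations of the `z_c ^ (d - 1) * z_c'`.
Let `d ≥ 3`. These `q ^ 2` forms are then independent. The only motions of `L` with no first order
effect are those inside `L`, so the implicit function theorem makes the branch of `L` a submanifold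
(`exists_isLocalBranch_of_injective`). Its tangent space is `T = I(L) + J` (`tangentForms_eq_sup`),
of codimension `multichoose q d - q ^ 2` with `q = k + 1`, which is the number `C` read as a power
series coefficient (`cNumber_onesThen`).

Upper bound: the intersection of the branches has dimension at most that of `T ∩ T'`. As `I(L) +
I(L') = I(L ∩ L')`, the sum `T + T'` is `I(L ∩ L') + J`, a space of the same kind, so all dimensions
are known (`finrank_tangentForms_inf`). If `L ∩ L' = 0`, the sum is everything, which is
transversality.

Lower bound: submanifolds may meet in less than `T ∩ T'` suggests. However, composing forms of `I(L)
∩ I(L')` near `F` with coordinate changes near the identity stays in both branches, and the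
differential of this family at `F` has image `(I(L) ∩ I(L')) + J`. The crux is
`tangentForms_inf_le`: this image already contains `T ∩ T'`.

For `d ≤ 2` the first order motions reach every form, both branches are neighbourhoods of `F`, and
all the numbers `C` involved vanish. -/

/-! ### Evaluation of forms -/

namespace Form

variable {N d q : ℕ}

/-- The value of a form at a point, as a linear function of the form. -/
noncomputable def evalAt (x : Fin N → ℂ) : Form N d →ₗ[ℂ] ℂ where
  toFun c := MvPolynomial.eval x c.toPoly
  map_add' c c' := by simp [Form.toPoly, Finset.sum_add_distrib]
  map_smul' t c := by
    simp [Form.toPoly, Finset.mul_sum, MvPolynomial.eval_monomial, mul_assoc]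

theorem evalAt_apply (x : Fin N → ℂ) (c : Form N d) :
    evalAt x c = MvPolynomial.eval x c.toPoly := rfl

theorem evalAt_eq_sum (x : Fin N → ℂ) (c : Form N d) :
    evalAt x c = ∑ i : MonomialIndex N d, c i * ∏ j, x j ^ i.1 j := by
  rw [evalAt_apply, Form.toPoly, map_sum]
  refine Finset.sum_congr rfl fun i _ => ?_
  rw [MvPolynomial.eval_monomial, Finsupp.prod_fintype _ _ (by simp)]
  rfl

theorem isHomogeneous_toPoly (c : Form N d) : c.toPoly.IsHomogeneous d := by
  refine MvPolynomial.IsHomogeneous.sum _ _ _ fun i _ =>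
    MvPolynomial.isHomogeneous_monomial _ ?_
  rw [Finsupp.degree_eq_sum]
  exact (Finset.mem_piAntidiag.1 i.2).1

theorem ofPoly_toPoly (c : Form N d) : Form.ofPoly d c.toPoly = c := by
  funext i
  simp only [Form.ofPoly, Form.toPoly, MvPolynomial.coeff_sum, MvPolynomial.coeff_monomial]
  rw [Finset.sum_eq_single i]
  · simp
  · intro j _ hj
    rw [if_neg]
    intro h
    exact hj (Subtype.ext (Finsupp.equivFunOnFinite.symm.injective h))
  · simp

theorem toPoly_ofPoly {p : MvPolynomial (Fin N) ℂ} (hp : p.IsHomogeneous d) :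
    (Form.ofPoly d p).toPoly = p := by
  ext m
  simp only [Form.ofPoly, Form.toPoly, MvPolynomial.coeff_sum, MvPolynomial.coeff_monomial]
  by_cases hm : m.degree = d
  · have hmem : (m : Fin N → ℕ) ∈ Finset.piAntidiag (Finset.univ : Finset (Fin N)) d := by
      rw [Finset.mem_piAntidiag]
      exact ⟨by rw [← hm, Finsupp.degree_eq_sum], by simp⟩
    have hsymm : Finsupp.equivFunOnFinite.symm (m : Fin N → ℕ) = m := by ext; rfl
    rw [Finset.sum_eq_single (⟨m, hmem⟩ : MonomialIndex N d)]
    · rw [if_pos hsymm, hsymm]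
    · intro j _ hj
      rw [if_neg]
      rintro rfl
      exact hj (Subtype.ext rfl)
    · simp
  · rw [Finset.sum_eq_zero, hp.coeff_eq_zero hm]
    intro j _
    rw [if_neg]
    rintro rfl
    apply hm
    rw [Finsupp.degree_eq_sum]
    exact (Finset.mem_piAntidiag.1 j.2).1

theorem evalAt_ofPoly {p : MvPolynomial (Fin N) ℂ} (hp : p.IsHomogeneous d) (x : Fin N → ℂ) :
    evalAt x (Form.ofPoly d p) = MvPolynomial.eval x p := by
  rw [evalAt_apply, toPoly_ofPoly hp]

theorem ext_evalAt {c c' : Form N d} (h : ∀ x, evalAt x c = evalAt x c') : c = c' := by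
  rw [← ofPoly_toPoly c, ← ofPoly_toPoly c']
  congr 1
  exact MvPolynomial.funext h

theorem evalAt_smul (t : ℂ) (x : Fin N → ℂ) (c : Form N d) :
    evalAt (t • x) c = t ^ d * evalAt x c := by
  simp only [evalAt_eq_sum, Pi.smul_apply, smul_eq_mul, mul_pow, Finset.prod_mul_distrib,
    Finset.prod_pow_eq_pow_sum, Finset.mul_sum]
  refine Finset.sum_congr rfl fun i _ => ?_
  rw [(Finset.mem_piAntidiag.1 i.2).1]
  ring

theorem evalAt_zero (hd : d ≠ 0) (c : Form N d) : evalAt 0 c = 0 := by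
  simpa [hd] using evalAt_smul 0 0 c

theorem isHomogeneous_fermat (N d : ℕ) :
    (∑ j : Fin N, (MvPolynomial.X j : MvPolynomial (Fin N) ℂ) ^ d).IsHomogeneous d :=
  MvPolynomial.IsHomogeneous.sum _ _ _ fun j _ => MvPolynomial.isHomogeneous_X_pow j d

theorem evalAt_fermat (x : Fin N → ℂ) : evalAt x (fermat N d) = ∑ j, x j ^ d := by
  rw [fermat, evalAt_ofPoly (isHomogeneous_fermat N d)]
  simp

theorem finrank_eq (N d : ℕ) : Module.finrank ℂ (Form N d) = N.multichoose d := by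
  have h := Finset.card_finsuppAntidiag_nat_eq_multichoose (s := (Finset.univ : Finset (Fin N))) d
  rw [Finset.finsuppAntidiag, Finset.card_map, Finset.card_attach, Finset.card_fin] at h
  rw [Module.finrank_fintype_fun_eq_card, Fintype.card_coe, h]

/-! ### Pullback of forms along linear maps -/

/-- The polynomial obtained by substituting linear forms for the variables. -/
noncomputable def substPoly (M : (Fin q → ℂ) →L[ℂ] (Fin N → ℂ)) :
    MvPolynomial (Fin N) ℂ →ₐ[ℂ] MvPolynomial (Fin q) ℂ :=
  MvPolynomial.aeval fun j =>
    ∑ l : Fin q, MvPolynomial.C (M (Pi.single l 1) j) * MvPolynomial.X l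

theorem eval_substPoly (M : (Fin q → ℂ) →L[ℂ] (Fin N → ℂ)) (p : MvPolynomial (Fin N) ℂ)
    (z : Fin q → ℂ) :
    MvPolynomial.eval z (substPoly M p) = MvPolynomial.eval (M z) p := by
  have hM : ∀ j, M z j = ∑ l : Fin q, M (Pi.single l 1) j * z l := by
    intro j
    conv_lhs => rw [← Finset.univ_sum_single z, map_sum, Finset.sum_apply]
    refine Finset.sum_congr rfl fun l _ => ?_
    have : Pi.single l (z l) = z l • (Pi.single l (1 : ℂ) : Fin q → ℂ) := by
      simp [← Pi.single_smul]
    rw [this, map_smul, Pi.smul_apply, smul_eq_mul, mul_comm]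
  induction p using MvPolynomial.induction_on with
  | C a => simp [substPoly]
  | add p p' hp hp' => simp only [map_add, hp, hp']
  | mul_X p j hp =>
    rw [map_mul, map_mul, map_mul, hp]
    simp [substPoly, hM]

theorem isHomogeneous_substPoly (M : (Fin q → ℂ) →L[ℂ] (Fin N → ℂ)) {p : MvPolynomial (Fin N) ℂ}
    (hp : p.IsHomogeneous d) : (substPoly M p).IsHomogeneous d := by
  have := hp.aeval (fun j => ∑ l : Fin q, MvPolynomial.C (M (Pi.single l 1) j) * MvPolynomial.X l)
      (n := 1) (fun j =>
    MvPolynomial.IsHomogeneous.sum _ _ _ fun l _ => MvPolynomial.isHomogeneous_C_mul_X _ _)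
  rwa [one_mul] at this

/-- The pullback of a form along a linear map. -/
noncomputable def pullback (M : (Fin q → ℂ) →L[ℂ] (Fin N → ℂ)) : Form N d →ₗ[ℂ] Form q d where
  toFun c := Form.ofPoly d (substPoly M c.toPoly)
  map_add' c c' := by
    funext i
    simp [Form.ofPoly, Form.toPoly, Finset.sum_add_distrib]
  map_smul' t c := by
    funext i
    have h : (t • c).toPoly = t • c.toPoly := by
      simp [Form.toPoly, Finset.smul_sum, MvPolynomial.smul_monomial]
    rw [h, map_smul]
    simp [Form.ofPoly]

theorem evalAt_pullback (M : (Fin q → ℂ) →L[ℂ] (Fin N → ℂ)) (c : Form N d) (z : Fin q → ℂ) :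
    evalAt z (pullback M c) = evalAt (M z) c := by
  change evalAt z (Form.ofPoly d (substPoly M c.toPoly)) = _
  rw [evalAt_ofPoly (isHomogeneous_substPoly M c.isHomogeneous_toPoly), eval_substPoly,
      evalAt_apply]

theorem pullback_surjective {M : (Fin q → ℂ) →L[ℂ] (Fin N → ℂ)}
    {l : (Fin N → ℂ) →L[ℂ] (Fin q → ℂ)} (h : ∀ z, l (M z) = z) :
    Function.Surjective (pullback M : Form N d →ₗ[ℂ] Form q d) := by
  intro c
  refine ⟨pullback l c, ext_evalAt fun z => ?_⟩
  rw [evalAt_pullback, evalAt_pullback, h]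

/-- Each coefficient is polynomial in the entries of `M`. The induction keeps `m` general because
multiplying by a variable shifts exponents. -/
theorem analyticAt_coeff_substPoly (p : MvPolynomial (Fin N) ℂ) (m : Fin q →₀ ℕ)
    (M : (Fin q → ℂ) →L[ℂ] (Fin N → ℂ)) :
    AnalyticAt ℂ (fun M => (substPoly M p).coeff m) M := by
  induction p using MvPolynomial.induction_on generalizing m with
  | C a => simp only [substPoly, MvPolynomial.aeval_C]; exact analyticAt_const
  | add p p' hp hp' => simpa only [map_add, MvPolynomial.coeff_add] using (hp m).fun_add (hp' m)
  | mul_X p j hp =>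
    have h : ∀ M : (Fin q → ℂ) →L[ℂ] (Fin N → ℂ), (substPoly M (p * MvPolynomial.X j)).coeff m =
        ∑ l : Fin q, M (Pi.single l 1) j *
          if l ∈ m.support then (substPoly M p).coeff (m - Finsupp.single l 1) else 0 := by
      intro M
      rw [map_mul]
      conv_lhs => rw [substPoly, MvPolynomial.aeval_X, Finset.mul_sum, MvPolynomial.coeff_sum]
      refine Finset.sum_congr rfl fun l _ => ?_
      rw [mul_left_comm, MvPolynomial.coeff_C_mul, MvPolynomial.coeff_mul_X', substPoly]
    simp only [h]
    refine Finset.univ.analyticAt_fun_sum fun l _ => AnalyticAt.mul ?_ ?_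
    · exact ((ContinuousLinearMap.proj (R := ℂ) (φ := fun _ : Fin N => ℂ) j).comp
          (ContinuousLinearMap.apply ℂ (Fin N → ℂ) (Pi.single l (1 : ℂ) : Fin q → ℂ))).analyticAt M
    · split_ifs
      · exact hp _
      · exact analyticAt_const

/-- The pullback as a function of the form and of the linear map. -/
theorem analyticAt_pullback (v : Form N d × ((Fin q → ℂ) →L[ℂ] (Fin N → ℂ))) :
    AnalyticAt ℂ (fun v : Form N d × ((Fin q → ℂ) →L[ℂ] (Fin N → ℂ)) => pullback v.2 v.1) v := by
  rw [analyticAt_pi_iff]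
  intro i
  have h : ∀ v : Form N d × ((Fin q → ℂ) →L[ℂ] (Fin N → ℂ)), pullback v.2 v.1 i =
      ∑ j : MonomialIndex N d, v.1 j * (substPoly v.2 (MvPolynomial.monomial
        (Finsupp.equivFunOnFinite.symm j.1) 1)).coeff (Finsupp.equivFunOnFinite.symm i.1) := by
    intro v
    change (substPoly v.2 v.1.toPoly).coeff _ = _
    rw [Form.toPoly, map_sum, MvPolynomial.coeff_sum]
    refine Finset.sum_congr rfl fun j _ => ?_
    rw [← MvPolynomial.coeff_C_mul, ← MvPolynomial.algebraMap_eq, ← Algebra.smul_def, ← map_smul,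
        MvPolynomial.smul_monomial, smul_eq_mul, mul_one]
  simp only [h]
  refine Finset.univ.analyticAt_fun_sum fun l _ => AnalyticAt.mul ?_ ?_
  · exact ((ContinuousLinearMap.proj (R := ℂ) (φ := fun _ : MonomialIndex N d => ℂ) l).comp
        (ContinuousLinearMap.fst ℂ _ _)).analyticAt v
  · exact (analyticAt_coeff_substPoly _ _ v.2).fun_comp analyticAt_snd

end Form

/-! ### Derivative of the pullback in the linear map. -/

namespace Form

variable {N d q : ℕ}

/-- The partial derivative of the pullback with respect to the linear map. -/
noncomputable def pullbackDeriv (c : Form N d) (M : (Fin q → ℂ) →L[ℂ] (Fin N → ℂ)) :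
    ((Fin q → ℂ) →L[ℂ] (Fin N → ℂ)) →L[ℂ] Form q d :=
  (fderiv ℂ (fun v : Form N d × ((Fin q → ℂ) →L[ℂ] (Fin N → ℂ)) => pullback v.2 v.1) (c, M)).comp
    (ContinuousLinearMap.inr ℂ _ _)

theorem hasFDerivAt_pullback (v : Form N d × ((Fin q → ℂ) →L[ℂ] (Fin N → ℂ))) :
    HasFDerivAt (fun v : Form N d × ((Fin q → ℂ) →L[ℂ] (Fin N → ℂ)) => pullback v.2 v.1)
      (fderiv ℂ (fun v : Form N d × ((Fin q → ℂ) →L[ℂ] (Fin N → ℂ)) => pullback v.2 v.1) v) v :=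
  (analyticAt_pullback v).differentiableAt.hasFDerivAt

theorem fderiv_pullback_apply (c : Form N d) (M : (Fin q → ℂ) →L[ℂ] (Fin N → ℂ))
    (G : Form N d) (A : (Fin q → ℂ) →L[ℂ] (Fin N → ℂ)) :
    fderiv ℂ (fun v : Form N d × ((Fin q → ℂ) →L[ℂ] (Fin N → ℂ)) => pullback v.2 v.1) (c, M) (G,
        A) =
      pullback M G + pullbackDeriv c M A := by
  have h1 : fderiv ℂ (fun v : Form N d × ((Fin q → ℂ) →L[ℂ] (Fin N → ℂ)) => pullback v.2 v.1)
      (c, M) (G, 0) = pullback M G := by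
    have h2 : HasFDerivAt (fun c : Form N d => (c, M))
        (ContinuousLinearMap.inl ℂ (Form N d) ((Fin q → ℂ) →L[ℂ] (Fin N → ℂ))) c :=
      hasFDerivAt_prodMk_left c M
    have h3 := HasFDerivAt.comp c (hasFDerivAt_pullback (c, M)) h2
    have h4 : HasFDerivAt (fun c : Form N d => pullback M c)
      (LinearMap.toContinuousLinearMap (pullback M : Form N d →ₗ[ℂ] Form q d)) c :=
      (LinearMap.toContinuousLinearMap (pullback M : Form N d →ₗ[ℂ] Form q d)).hasFDerivAt
    exact DFunLike.congr_fun (h3.unique h4) G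
  rw [← h1, pullbackDeriv, ContinuousLinearMap.comp_apply, ← map_add]
  simp

theorem evalAt_pullbackDeriv_fermat (M A : (Fin q → ℂ) →L[ℂ] (Fin N → ℂ)) (z : Fin q → ℂ) :
    evalAt z (pullbackDeriv (fermat N d) M A) = d * ∑ i, M z i ^ (d - 1) * A z i := by
  have h1 : HasDerivAt (fun t : ℂ => (fermat N d, M + t • A))
      ((0 : Form N d), A) 0 := by
    have := ((hasDerivAt_id (0 : ℂ)).smul_const A).const_add M
    rw [one_smul] at this
    exact (hasDerivAt_const _ _).prodMk this
  have h0 : (fermat N d, M) = (fermat N d, M + (0 : ℂ) • A) := by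
    congr 1
    ext1 z
    simp
  have h3 := (LinearMap.toContinuousLinearMap
    (evalAt z : Form q d →ₗ[ℂ] ℂ)).hasFDerivAt.comp_hasDerivAt 0
    ((hasFDerivAt_pullback (fermat N d, M)).comp_hasDerivAt_of_eq 0 h1 h0)
  have h4 : HasDerivAt (fun t : ℂ => ∑ i, (M z i + t * A z i) ^ d)
      (d * ∑ i, M z i ^ (d - 1) * A z i) 0 := by
    rw [Finset.mul_sum]
    refine HasDerivAt.fun_sum fun i _ => ?_
    have := ((((hasDerivAt_id (0 : ℂ)).mul_const (A z i)).const_add (M z i))).fun_pow d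
    simpa [mul_assoc] using this
  have h5 : (⇑(LinearMap.toContinuousLinearMap (evalAt z : Form q d →ₗ[ℂ] ℂ)) ∘
      (fun v : Form N d × ((Fin q → ℂ) →L[ℂ] (Fin N → ℂ)) => pullback v.2 v.1) ∘
      fun t : ℂ => (fermat N d, M + t • A)) = fun t : ℂ => ∑ i, (M z i + t * A z i) ^ d := by
    funext t
    simp [evalAt_pullback, evalAt_fermat]
  rw [h5] at h3
  rw [← h3.unique h4, fderiv_pullback_apply]
  simp

/-! ### Smoothness is an open condition -/

theorem evalAt_ofPoly_pderiv (c : Form N d) (j : Fin N) (x : Fin N → ℂ) :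
    evalAt x (Form.ofPoly (d - 1) (MvPolynomial.pderiv j c.toPoly)) =
      MvPolynomial.eval x (MvPolynomial.pderiv j c.toPoly) :=
  evalAt_ofPoly c.isHomogeneous_toPoly.pderiv x

theorem continuous_eval_pderiv (j : Fin N) :
    Continuous fun v : Form N d × (Fin N → ℂ) =>
      MvPolynomial.eval v.2 (MvPolynomial.pderiv j v.1.toPoly) := by
  have h : ∀ v : Form N d × (Fin N → ℂ), MvPolynomial.eval v.2 (MvPolynomial.pderiv j v.1.toPoly) =
      ∑ i : MonomialIndex N d, v.1 i * MvPolynomial.eval v.2 (MvPolynomial.pderiv j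
        (MvPolynomial.monomial (Finsupp.equivFunOnFinite.symm i.1) 1)) := by
    intro v
    rw [Form.toPoly, map_sum, map_sum]
    refine Finset.sum_congr rfl fun i _ => ?_
    rw [← MvPolynomial.smul_eval, ← Derivation.map_smul, MvPolynomial.smul_monomial, smul_eq_mul,
        mul_one]
  simp only [h]
  refine continuous_finsetSum _ fun i _ => Continuous.mul (by fun_prop) ?_
  exact (MvPolynomial.continuous_eval _).comp continuous_snd

/-- The partial derivatives stay without common zero near each point of the unit sphere. Compactness
makes this uniform, and homogeneity extends it to all nonzero points. -/
theorem eventually_isSmooth {c₀ : Form N d}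
    (h : ∀ x : Fin N → ℂ, x ≠ 0 → ∃ j, MvPolynomial.eval x (MvPolynomial.pderiv j c₀.toPoly) ≠ 0) :
    ∀ᶠ c in 𝓝 c₀, c.IsSmooth := by
  have hK : ∀ᶠ c in 𝓝 c₀, ∀ x ∈ Metric.sphere (0 : Fin N → ℂ) 1,
      ∃ j, MvPolynomial.eval x (MvPolynomial.pderiv j c.toPoly) ≠ 0 := by
    refine (isCompact_sphere (0 : Fin N → ℂ) 1).eventually_forall_of_forall_eventually
      fun x hx => ?_
    obtain ⟨j, hj⟩ := h x (by rintro rfl; simp at hx)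
    have h1 : ContinuousAt (fun v : Form N d × (Fin N → ℂ) =>
      MvPolynomial.eval v.2 (MvPolynomial.pderiv j v.1.toPoly)) (c₀, x) :=
      (continuous_eval_pderiv j).continuousAt
    filter_upwards [h1.eventually_ne hj] with v hv using ⟨j, hv⟩
  filter_upwards [hK] with c hc x hx _
  obtain ⟨j, hj⟩ := hc (((‖x‖⁻¹ : ℝ) : ℂ) • x) (by simp [norm_smul, norm_ne_zero_iff.2 hx])
  refine ⟨j, fun h0 => hj ?_⟩
  rw [← evalAt_ofPoly_pderiv, evalAt_smul, evalAt_ofPoly_pderiv, h0, mul_zero]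

theorem eventually_isSmooth_fermat (hd : d ≠ 0) : ∀ᶠ c in 𝓝 (fermat N d), c.IsSmooth := by
  refine eventually_isSmooth fun x hx => ?_
  obtain ⟨j, hj⟩ := Function.ne_iff.1 hx
  refine ⟨j, ?_⟩
  rw [fermat, toPoly_ofPoly (isHomogeneous_fermat N d), map_sum, map_sum, Finset.sum_eq_single j]
  · simpa [MvPolynomial.pderiv_pow, hd] using fun h => absurd h hj
  · intro i _ hi
    simp [MvPolynomial.pderiv_X_of_ne hi]
  · simp

end Form

/-! ### Neighbourhoods in the Grassmannian -/

section Grassmannian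

variable {r N : ℕ}

/-- A frame, as a linear map. -/
noncomputable def frameEquiv (r N : ℕ) :
    (Fin r → Fin N → ℂ) ≃ₗ[ℂ] ((Fin r → ℂ) →L[ℂ] (Fin N → ℂ)) :=
  (Pi.basisFun ℂ (Fin r)).constr ℂ ≪≫ₗ LinearMap.toContinuousLinearMap

theorem range_frameEquiv (v : Fin r → Fin N → ℂ) :
    LinearMap.range (frameEquiv r N v).toLinearMap = Submodule.span ℂ (Set.range v) :=
  (Pi.basisFun ℂ (Fin r)).constr_range ℂ

theorem continuous_frameEquiv : Continuous (frameEquiv r N) :=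
  (frameEquiv r N).toLinearMap.continuous_of_finiteDimensional

theorem continuous_frameEquiv_symm : Continuous (frameEquiv r N).symm :=
  (frameEquiv r N).symm.toLinearMap.continuous_of_finiteDimensional

/-- Independent frames form an open set on which `Frame.toGr` is continuous. -/
theorem Gr.eventually_range_mem {P : Gr r N} {M₀ : (Fin r → ℂ) →L[ℂ] (Fin N → ℂ)}
    (hP : P.1 = LinearMap.range M₀.toLinearMap) {S : Set (Gr r N)} (hS : S ∈ 𝓝 P) :
    ∀ᶠ M in 𝓝 M₀, ∃ L ∈ S, L.1 = LinearMap.range M.toLinearMap := by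
  have hli : LinearIndependent ℂ ((frameEquiv r N).symm M₀) := by
    rw [linearIndependent_iff_card_eq_finrank_span, Set.finrank, ← range_frameEquiv,
      LinearEquiv.apply_symm_apply, ← hP, P.2, Fintype.card_fin]
  let v₀ : Frame r N := ⟨_, hli⟩
  have hv₀ : Frame.toGr v₀ = P := by
    apply Subtype.ext
    rw [hP]
    change Submodule.span ℂ _ = _
    rw [← range_frameEquiv, LinearEquiv.apply_symm_apply]
  have h1 : Frame.toGr ⁻¹' S ∈ 𝓝 v₀ :=
    (continuous_coinduced_rng (f := Frame.toGr (r := r) (N := N))).continuousAt.preimage_mem_nhds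
      (by rwa [hv₀])
  have h2 : Subtype.val '' (Frame.toGr ⁻¹' S) ∈ 𝓝 ((frameEquiv r N).symm M₀) := by
    have ho : IsOpen {v : Fin r → Fin N → ℂ | LinearIndependent ℂ v} :=
      isOpen_setOfPred_linearIndependent
    rw [← ho.isOpenEmbedding_subtypeVal.map_nhds_eq v₀]
    exact image_mem_map h1
  filter_upwards [continuous_frameEquiv_symm.continuousAt.preimage_mem_nhds h2] with M hM
  obtain ⟨v, hv, hvM⟩ := hM
  refine ⟨Frame.toGr v, hv, ?_⟩
  change Submodule.span ℂ _ = _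
  rw [← range_frameEquiv, hvM, LinearEquiv.apply_symm_apply]

/-- The affine chart of planes complementary to the kernel of `l`. By definition of the quotient
topology, openness is tested on frames. -/
theorem Gr.mem_nhds_of_chart {P : Gr r N} {M₀ : (Fin r → ℂ) →L[ℂ] (Fin N → ℂ)}
    (hP : P.1 = LinearMap.range M₀.toLinearMap) {l : (Fin N → ℂ) →L[ℂ] (Fin r → ℂ)}
    (hl : l.comp M₀ = ContinuousLinearMap.id ℂ _) {U : Set ((Fin r → ℂ) →L[ℂ] (Fin N → ℂ))}
    (hU : U ∈ 𝓝 0) :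
    {L : Gr r N | ∃ A ∈ U, l.comp A = 0 ∧ L.1 = LinearMap.range (M₀ + A).toLinearMap} ∈ 𝓝 P := by
  obtain ⟨U', hU', hUo, h0⟩ := mem_nhds_iff.1 hU
  refine mem_of_superset (IsOpen.mem_nhds (s := {L : Gr r N | ∃ A ∈ U', l.comp A = 0 ∧
    L.1 = LinearMap.range (M₀ + A).toLinearMap}) ?_ ⟨0, h0, by simp, by simpa using hP⟩)
    fun L ⟨A, hA, h⟩ => ⟨A, hU' hA, h⟩
  rw [isOpen_coinduced, isOpen_iff_mem_nhds]
  rintro v₀ ⟨A₀, hA₀, hlA₀, hL⟩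
  change Submodule.span ℂ _ = _ at hL
  rw [← range_frameEquiv] at hL
  set F := frameEquiv r N v₀.1 with hF
  have hlM : ∀ z, l ((M₀ + A₀) z) = z := fun z => by
    have h1 := DFunLike.congr_fun hl z
    have h2 := DFunLike.congr_fun hlA₀ z
    simp at h1 h2
    simp [h1, h2]
  have hFinj : Function.Injective F := by
    have := v₀.2
    rw [linearIndependent_iff_card_eq_finrank_span, Set.finrank, ← range_frameEquiv, ← hF,
      Fintype.card_fin] at this
    rw [← ContinuousLinearMap.coe_coe, ← LinearMap.ker_eq_bot, ← Submodule.finrank_eq_zero (R := ℂ)]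
    have h2 := LinearMap.finrank_range_add_finrank_ker F.toLinearMap
    rw [Module.finrank_fin_fun] at h2
    omega
  have hunit : IsUnit (l.comp F) := by
    rw [ContinuousLinearMap.isUnit_iff_bijective]
    have hinj : Function.Injective (l.comp F) := by
      intro z w hzw
      have hz : ∀ z, ∃ z', F z = (M₀ + A₀) z' := fun z => by
        have : F z ∈ LinearMap.range F.toLinearMap := ⟨z, rfl⟩
        rw [hL] at this
        obtain ⟨z', hz'⟩ := this
        exact ⟨z', hz'.symm⟩
      obtain ⟨z', hz'⟩ := hz z
      obtain ⟨w', hw'⟩ := hz w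
      apply hFinj
      simp only [ContinuousLinearMap.comp_apply, hz', hw', hlM] at hzw
      rw [hz', hw', hzw]
    exact ⟨hinj, (LinearMap.injective_iff_surjective (f := (l.comp F).toLinearMap)).1 hinj⟩
  let g : Frame r N → ((Fin r → ℂ) →L[ℂ] (Fin r → ℂ)) := fun v => l.comp (frameEquiv r N v.1)
  have hgc : Continuous g := by
    have := continuous_frameEquiv (r := r) (N := N)
    fun_prop
  -- The chart coordinate of the plane: reparametrize the frame so that `l` becomes a left inverse,
  -- then subtract `M₀`.
  let B : Frame r N → ((Fin r → ℂ) →L[ℂ] (Fin N → ℂ)) := fun v =>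
    (frameEquiv r N v.1).comp (Ring.inverse (g v)) - M₀
  have hev : ∀ᶠ v in 𝓝 v₀, IsUnit (g v) := by
    exact hgc.continuousAt.preimage_mem_nhds (Units.isOpen.mem_nhds hunit)
  have hBc : ContinuousAt B v₀ := by
    have h1 : ContinuousAt (fun v => Ring.inverse (g v)) v₀ := by
      obtain ⟨u, hu⟩ := hunit
      have h := NormedRing.inverse_continuousAt u
      rw [hu] at h
      exact ContinuousAt.comp (f := g) h hgc.continuousAt
    have h2 : ContinuousAt (fun v : Frame r N => frameEquiv r N v.1) v₀ :=
      (continuous_frameEquiv.comp continuous_subtype_val).continuousAt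
    exact (h2.clm_comp h1).sub continuousAt_const
  have hB₀ : B v₀ = A₀ := by
    have h1 : (M₀ + A₀).comp (g v₀) = F := by
      ext1 z
      have : F z ∈ LinearMap.range F.toLinearMap := ⟨z, rfl⟩
      rw [hL] at this
      obtain ⟨z', hz'⟩ := this
      change (M₀ + A₀) (l (F z)) = F z
      rw [← hz']
      exact congrArg _ (hlM z')
    have h2 : F.comp (Ring.inverse (g v₀)) = M₀ + A₀ := by
      rw [← h1, ContinuousLinearMap.comp_assoc, ← ContinuousLinearMap.mul_def,
        Ring.mul_inverse_cancel _ hunit]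
      rfl
    change F.comp (Ring.inverse (g v₀)) - M₀ = A₀
    rw [h2, add_sub_cancel_left]
  filter_upwards [hev, hBc.preimage_mem_nhds (hUo.mem_nhds (by rwa [hB₀]))] with v hv hvU
  refine ⟨B v, hvU, ?_, ?_⟩
  · change l.comp ((frameEquiv r N v.1).comp (Ring.inverse (g v)) - M₀) = 0
    rw [ContinuousLinearMap.comp_sub, hl, ← ContinuousLinearMap.comp_assoc]
    change (g v) * (Ring.inverse (g v)) - 1 = 0
    rw [Ring.mul_inverse_cancel _ hv, sub_self]
  · change Submodule.span ℂ _ = LinearMap.range (M₀ + ((frameEquiv r N v.1).comp (Ring.inverse (g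
        v)) - M₀)).toLinearMap
    rw [← range_frameEquiv, add_sub_cancel]
    apply le_antisymm
    · rintro _ ⟨z, rfl⟩
      refine ⟨g v z, ?_⟩
      change frameEquiv r N v.1 ((Ring.inverse (g v) * g v) z) = _
      rw [Ring.inverse_mul_cancel _ hv]
      rfl
    · rintro _ ⟨z, rfl⟩
      exact ⟨Ring.inverse (g v) z, rfl⟩

end Grassmannian

/-! ### Dimensions of germs -/

section GermDimension

variable {E : Type*} [NormedAddCommGroup E] [NormedSpace ℂ E]

theorem IsSubmanifoldAt.congr {A B : Set E} {p : E} {T : Submodule ℂ E}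
    (h : IsSubmanifoldAt A p T) (hAB : A =ᶠ[𝓝 p] B) : IsSubmanifoldAt B p T := by
  obtain ⟨hp, c, g, hg, hs, hT, hA⟩ := h
  exact ⟨hAB.mem_iff.self_of_nhds.1 hp, c, g, hg, hs, hT, hAB.symm.trans hA⟩

theorem isSubmanifoldAt_of_mem_nhds {A : Set E} {p : E} (h : A ∈ 𝓝 p) :
    IsSubmanifoldAt A p ⊤ := by
  refine ⟨mem_of_mem_nhds h, 0, 0, analyticAt_const, fun y => ⟨0, Subsingleton.elim _ _⟩,
    ?_, ?_⟩
  · rw [eq_comm, eq_top_iff]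
    exact fun x _ => Subsingleton.elim _ _
  · refine eventuallyEq_set.2 (mem_of_superset h fun x hx => ?_)
    simp [hx]

/-- Restrict `f` to an affine `s`-plane through `x₀` on which its derivative is injective.
Injectivity persists nearby because a lower bound on the rank is an open condition. -/
theorem ContainsManifoldsNear.of_analyticAt [CompleteSpace E] {X : Type*} [NormedAddCommGroup X]
    [NormedSpace ℂ X]
    {A : Set E} {f : X → E} {x₀ : X} (hf : AnalyticAt ℂ f x₀) (hA : ∀ᶠ x in 𝓝 x₀, f x ∈ A) {s : ℕ}
    (hs : s ≤ Module.finrank ℂ (LinearMap.range (fderiv ℂ f x₀).toLinearMap)) :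
    ContainsManifoldsNear A (f x₀) s := by
  intro U hU
  obtain ⟨v, hv⟩ := exists_linearIndependent_of_le_finrank hs
  choose x hx using fun i => (v i).2
  let ι : (Fin s → ℂ) →L[ℂ] X := LinearMap.toContinuousLinearMap (Fintype.linearCombination ℂ x)
  have hinj : LinearMap.ker ((fderiv ℂ f x₀).comp ι).toLinearMap = ⊥ := by
    have h1 : LinearIndependent ℂ (fun i => (v i).1) :=
      hv.map' (Submodule.subtype _) (Submodule.ker_subtype _)
    rw [LinearMap.ker_eq_bot]
    have h2 := linearIndependent_iff_injective_fintypeLinearCombination.1 h1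
    convert h2 using 1
    funext w
    simp [ι, Fintype.linearCombination_apply, ← hx]
  let e : (Fin s → ℂ) → X := fun w => x₀ + ι w
  have he : ∀ w, HasFDerivAt e ι w := fun w => ι.hasFDerivAt.const_add x₀
  have hea : ∀ w, AnalyticAt ℂ e w := fun w => analyticAt_const.add (ι.analyticAt w)
  have he0 : Tendsto e (𝓝 0) (𝓝 x₀) := by
    have := (hea 0).continuousAt.tendsto
    simpa [e] using this
  have hev : ∀ᶠ w in 𝓝 (0 : Fin s → ℂ), AnalyticAt ℂ f (e w) ∧ f (e w) ∈ A ∧ f (e w) ∈ U ∧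
      Function.Injective ((fderiv ℂ f (e w)).comp ι) := by
    refine (he0.eventually hf.eventually_analyticAt).and ((he0.eventually hA).and
      ((he0.eventually (hf.continuousAt.eventually hU)).and ?_))
    have hc : ContinuousAt (fun y => (fderiv ℂ f y).comp ι) x₀ :=
      hf.fderiv.continuousAt.clm_comp continuousAt_const
    have ho := (isOpen_setOfPred_nat_le_rank (𝕜 := ℂ) (E := Fin s → ℂ) (F := E) s).mem_nhds
      (x := (fderiv ℂ f x₀).comp ι) (by
        have h1 := LinearMap.finrank_range_of_inj (LinearMap.ker_eq_bot.1 hinj)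
        rw [Module.finrank_fin_fun] at h1
        rw [Set.mem_ofPred_eq, LinearMap.rank, ← Module.finrank_eq_rank, h1])
    filter_upwards [he0.eventually (hc.eventually ho)] with w hw
    have h1 : _ ≤ LinearMap.rank ((fderiv ℂ f (e w)).comp ι).toLinearMap := hw
    rw [LinearMap.rank, ← Module.finrank_eq_rank, Nat.cast_le] at h1
    have h2 := LinearMap.finrank_range_add_finrank_ker ((fderiv ℂ f (e w)).comp ι).toLinearMap
    rw [Module.finrank_fin_fun] at h2
    have h3 : Module.finrank ℂ (LinearMap.ker ((fderiv ℂ f (e w)).comp ι).toLinearMap) = 0 := by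
      omega
    exact LinearMap.ker_eq_bot.1 (Submodule.finrank_eq_zero.1 h3)
  obtain ⟨W, hW, hWo, h0⟩ := eventually_nhds_iff.1 hev
  refine ⟨W, f ∘ e, hWo, ⟨0, h0⟩, fun w hw => (hW w hw).1.comp (hea w), fun w hw => ?_,
    fun w hw => ⟨(hW w hw).2.1, (hW w hw).2.2.1⟩⟩
  rw [((hW w hw).1.differentiableAt.hasFDerivAt.comp w (he w)).fderiv]
  exact (hW w hw).2.2.2

/-- The manifolds lie near `p` but need not pass through it. Their tangent spaces lie in the kernel
of the derivative of `g` at nearby points, and the dimension of this kernel is upper semicontinuous.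
-/
theorem ContainsManifoldsNear.le_finrank_ker [FiniteDimensional ℂ E] {F : Type*}
    [NormedAddCommGroup F] [NormedSpace ℂ F]
    [CompleteSpace F]
    {A : Set E} {p : E} {g : E → F} (hg : AnalyticAt ℂ g p) (hA : ∀ᶠ x in 𝓝 p, x ∈ A → g x = 0)
    {s : ℕ} (h : ContainsManifoldsNear A p s) :
    s ≤ Module.finrank ℂ (LinearMap.ker (fderiv ℂ g p).toLinearMap) := by
  have hrank : ∀ᶠ x in 𝓝 p, Module.finrank ℂ (LinearMap.ker (fderiv ℂ g x).toLinearMap) ≤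
      Module.finrank ℂ (LinearMap.ker (fderiv ℂ g p).toLinearMap) := by
    have ho := (isOpen_setOfPred_nat_le_rank (𝕜 := ℂ) (E := E) (F := F)
      (Module.finrank ℂ (LinearMap.range (fderiv ℂ g p).toLinearMap))).mem_nhds
      (x := fderiv ℂ g p) (Module.finrank_eq_rank ℂ _).le
    filter_upwards [hg.fderiv.continuousAt.eventually ho] with x hx
    have h1 := LinearMap.finrank_range_add_finrank_ker (fderiv ℂ g x).toLinearMap
    have h2 := LinearMap.finrank_range_add_finrank_ker (fderiv ℂ g p).toLinearMap
    have h3 : Module.finrank ℂ (LinearMap.range (fderiv ℂ g p).toLinearMap) ≤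
        Module.finrank ℂ (LinearMap.range (fderiv ℂ g x).toLinearMap) := by
      have h4 : _ ≤ LinearMap.rank (fderiv ℂ g x).toLinearMap := hx
      rw [LinearMap.rank, ← Module.finrank_eq_rank] at h4
      exact_mod_cast h4
    omega
  obtain ⟨W, φ, hWo, ⟨w, hw⟩, hφ, hinj, hmaps⟩ := h _ ((hg.eventually_analyticAt.and hA).and hrank)
  obtain ⟨-, ⟨han, -⟩, hle⟩ := hmaps hw
  refine le_trans ?_ hle
  have h0 : (fderiv ℂ g (φ w)).comp (fderiv ℂ φ w) = 0 := by
    rw [← fderiv_comp w han.differentiableAt (hφ w hw).differentiableAt]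
    have : g ∘ φ =ᶠ[𝓝 w] fun _ => 0 := by
      filter_upwards [hWo.mem_nhds hw] with y hy
      exact (hmaps hy).2.1.2 (hmaps hy).1
    rw [this.fderiv_eq, fderiv_fun_const]
    rfl
  have := LinearMap.finrank_le_finrank_of_injective (f := (fderiv ℂ φ w).toLinearMap.codRestrict
    (LinearMap.ker (fderiv ℂ g (φ w)).toLinearMap) fun y => DFunLike.congr_fun h0 y)
    fun y z hyz => hinj w hw (congrArg Subtype.val hyz)
  rwa [Module.finrank_fin_fun] at this

theorem ContainsManifoldsNear.le_finrank_inf [FiniteDimensional ℂ E] {A B : Set E} {p : E} {T T' :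
    Submodule ℂ E}
    (hA : IsSubmanifoldAt A p T) (hB : IsSubmanifoldAt B p T') {s : ℕ}
    (h : ContainsManifoldsNear (A ∩ B) p s) : s ≤ Module.finrank ℂ ↥(T ⊓ T') := by
  obtain ⟨-, c, g, hg, -, rfl, hgA⟩ := hA
  obtain ⟨-, c', g', hg', -, rfl, hgB⟩ := hB
  have := h.le_finrank_ker (hg.prod hg') (by
    filter_upwards [hgA.mem_iff, hgB.mem_iff] with x hx hx' hxAB
    exact Prod.ext (hx.1 hxAB.1) (hx'.1 hxAB.2))
  rwa [hg.differentiableAt.fderiv_prodMk hg'.differentiableAt,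
    ContinuousLinearMap.ker_prod] at this

end GermDimension

/-! ### Local branches -/

section LocalBranch

variable {r N d : ℕ} {P : Gr r N} {c₀ : Form N d} {M₀ : (Fin r → ℂ) →L[ℂ] (Fin N → ℂ)}

theorem Form.pullback_eq_zero_iff {c : Form N d} {M : (Fin r → ℂ) →L[ℂ] (Fin N → ℂ)} :
    Form.pullback M c = 0 ↔
      ∀ x ∈ LinearMap.range M.toLinearMap, MvPolynomial.eval x c.toPoly = 0 := by
  constructor
  · rintro h _ ⟨z, rfl⟩
    rw [← Form.evalAt_apply]
    change Form.evalAt (M z) c = 0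
    rw [← Form.evalAt_pullback, h, map_zero]
  · intro h
    refine Form.ext_evalAt fun z => ?_
    rw [Form.evalAt_pullback, map_zero]
    exact h _ ⟨z, rfl⟩

/-- The map `(c, M) ↦ (pullback M c, c)` is a submersion at `(c₀, M₀)`, hence open there, so `(0,
c)` is attained with `M` near `M₀` for every `c` near `c₀`. -/
theorem hypersurfacesContaining_mem_nhds (hP : P.1 = LinearMap.range M₀.toLinearMap)
    (hc₀ : Form.pullback M₀ c₀ = 0) (hsmooth : ∀ᶠ c in 𝓝 c₀, c.IsSmooth)
    (hsurj : Function.Surjective (Form.pullbackDeriv c₀ M₀)) {S : Set (Gr r N)} (hS : S ∈ 𝓝 P) :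
    hypersurfacesContaining d S ∈ 𝓝 c₀ := by
  let R : Form N d × ((Fin r → ℂ) →L[ℂ] (Fin N → ℂ)) → Form r d := fun v => Form.pullback v.2 v.1
  have hR : HasStrictFDerivAt R (fderiv ℂ R (c₀, M₀)) (c₀, M₀) :=
    (Form.analyticAt_pullback (c₀, M₀)).hasStrictFDerivAt
  have hf := hR.prodMk (hasStrictFDerivAt_fst (𝕜 := ℂ) (p := (c₀, M₀)))
  have hmap := hf.map_nhds_eq_of_surj (by
    rw [LinearMap.range_eq_top]
    rintro ⟨y, G⟩
    obtain ⟨A, hA⟩ := hsurj (y - Form.pullback M₀ G)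
    refine ⟨(G, A), Prod.ext ?_ rfl⟩
    change fderiv ℂ R (c₀, M₀) (G, A) = y
    rw [Form.fderiv_pullback_apply, hA, add_sub_cancel])
  have h1 : {v : Form N d × ((Fin r → ℂ) →L[ℂ] (Fin N → ℂ)) |
      ∃ L ∈ S, L.1 = LinearMap.range v.2.toLinearMap} ∈ 𝓝 (c₀, M₀) :=
    (continuous_snd.continuousAt (x := (c₀, M₀))).preimage_mem_nhds
      (Gr.eventually_range_mem hP hS)
  have h2 := image_mem_map (m := fun v => (R v, v.1)) h1
  rw [hmap] at h2
  have h3 : R (c₀, M₀) = 0 := hc₀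
  rw [h3] at h2
  have h4 : ContinuousAt (fun c : Form N d => ((0 : Form r d), c)) c₀ := by fun_prop
  filter_upwards [hsmooth, h4.preimage_mem_nhds h2] with c hc hcS
  obtain ⟨⟨c', M⟩, ⟨L, hLS, hL⟩, hv⟩ := hcS
  obtain ⟨hv1, rfl⟩ := Prod.ext_iff.1 hv
  refine ⟨hc, L, hLS, ?_⟩
  rw [hL]
  exact Form.pullback_eq_zero_iff.1 hv1

/-- Lyapunov–Schmidt reduction. In the chart of planes `M₀ + A` with `l ∘ A = 0` the derivative `D`
is injective, so the component `π₁` of the vanishing condition determines the plane as a function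
`α` of the form. The component `π₂` in the cokernel of `D` then gives the equations of the branch,
independent because restriction of forms to the plane is surjective. -/
theorem exists_isLocalBranch_of_injective (hP : P.1 = LinearMap.range M₀.toLinearMap)
    (hc₀ : Form.pullback M₀ c₀ = 0) (hsmooth : ∀ᶠ c in 𝓝 c₀, c.IsSmooth)
    {l : (Fin N → ℂ) →L[ℂ] (Fin r → ℂ)} (hl : l.comp M₀ = ContinuousLinearMap.id ℂ _)
    (hker : ∀ A, Form.pullbackDeriv c₀ M₀ A = 0 ↔ ∃ B : (Fin r → ℂ) →L[ℂ] (Fin r → ℂ), A = M₀.comp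
        B) :
    ∃ V, IsLocalBranch P c₀ V ∧ IsSubmanifoldAt V c₀
      ((LinearMap.range (Form.pullbackDeriv c₀ M₀).toLinearMap).comap (Form.pullback M₀)) := by
  set D := Form.pullbackDeriv c₀ M₀ with hD
  let R : Form N d × ((Fin r → ℂ) →L[ℂ] (Fin N → ℂ)) → Form r d := fun v => Form.pullback v.2 v.1
  -- a linear parametrization of the maps into the kernel of `l`
  obtain ⟨n, j, k, hkj, hlj, hjk⟩ : ∃ (n : ℕ)
      (j : (Fin n → ℂ) →L[ℂ] ((Fin r → ℂ) →L[ℂ] (Fin N → ℂ)))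
      (k : ((Fin r → ℂ) →L[ℂ] (Fin N → ℂ)) →L[ℂ] (Fin n → ℂ)),
      (∀ x, k (j x) = x) ∧ (∀ x, l.comp (j x) = 0) ∧ ∀ A, l.comp A = 0 → j (k A) = A := by
    let H := LinearMap.ker
      (ContinuousLinearMap.compL ℂ (Fin r → ℂ) (Fin N → ℂ) (Fin r → ℂ) l).toLinearMap
    let e := (Module.finBasis ℂ H).equivFun
    let j : (Fin (Module.finrank ℂ H) → ℂ) →ₗ[ℂ] ((Fin r → ℂ) →L[ℂ] (Fin N → ℂ)) :=
      H.subtype ∘ₗ e.symm.toLinearMap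
    have hj : LinearMap.ker j = ⊥ := by
      rw [LinearMap.ker_eq_bot]
      exact H.subtype_injective.comp e.symm.injective
    obtain ⟨k, hk⟩ := LinearMap.exists_leftInverse_of_injective j hj
    have hkj : ∀ x, k (j x) = x := DFunLike.congr_fun hk
    refine ⟨_, LinearMap.toContinuousLinearMap j, LinearMap.toContinuousLinearMap k, hkj,
      fun x => (e.symm x).2, fun A hA => ?_⟩
    have hA' : j (e ⟨A, hA⟩) = A := congrArg Subtype.val (e.symm_apply_apply ⟨A, hA⟩)
    change j (k A) = A
    rw [← hA', hkj]
  have hDinj : ∀ x, D (j x) = 0 → x = 0 := by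
    intro x hx
    obtain ⟨B, hB⟩ := (hker _).1 hx
    have h1 := hlj x
    rw [hB, ← ContinuousLinearMap.comp_assoc, hl, ContinuousLinearMap.id_comp] at h1
    rw [← hkj x, hB, h1, ContinuousLinearMap.comp_zero, map_zero]
  have hrange : ∀ A, ∃ x, D (j x) = D A := by
    intro A
    -- Subtracting a motion of the plane inside itself brings `A` into the chart without changing `D
    -- A`.
    refine ⟨k (A - M₀.comp (l.comp A)), ?_⟩
    rw [hjk, map_sub, (hker _).2 ⟨_, rfl⟩, sub_zero]
    rw [ContinuousLinearMap.comp_sub, ← ContinuousLinearMap.comp_assoc, hl,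
      ContinuousLinearMap.id_comp, sub_self]
  obtain ⟨p₁, hp₁⟩ := LinearMap.exists_leftInverse_of_injective (D.comp j).toLinearMap
    (LinearMap.ker_eq_bot'.2 hDinj)
  let π₁ : Form r d →L[ℂ] (Fin n → ℂ) := LinearMap.toContinuousLinearMap p₁
  have hπ₁ : ∀ x, π₁ (D (j x)) = x := DFunLike.congr_fun hp₁
  let Q := Form r d ⧸ LinearMap.range D.toLinearMap
  let π₂ : Form r d →L[ℂ] (Fin (Module.finrank ℂ Q) → ℂ) := LinearMap.toContinuousLinearMap
    ((Module.finBasis ℂ Q).equivFun.toLinearMap ∘ₗ (LinearMap.range D.toLinearMap).mkQ)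
  have hπ₂surj : Function.Surjective π₂ :=
    (Module.finBasis ℂ Q).equivFun.surjective.comp (Submodule.mkQ_surjective _)
  have hπ₂ : ∀ y, π₂ y = 0 ↔ ∃ A, D A = y := fun y => by
    change (Module.finBasis ℂ Q).equivFun ((LinearMap.range D.toLinearMap).mkQ y) = 0 ↔ _
    rw [LinearEquiv.map_eq_zero_iff, Submodule.mkQ_apply, Submodule.Quotient.mk_eq_zero]
    rfl
  have hzero : ∀ y, π₁ y = 0 → π₂ y = 0 → y = 0 := by
    intro y h1 h2
    obtain ⟨A, rfl⟩ := (hπ₂ y).1 h2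
    obtain ⟨x, h⟩ := hrange A
    rw [← h] at h1 ⊢
    rw [hπ₁] at h1
    rw [h1, map_zero, map_zero]
  -- the implicit equation for the plane in the chart
  let s : Form N d × (Fin n → ℂ) → Form N d × ((Fin r → ℂ) →L[ℂ] (Fin N → ℂ)) := fun v => (v.1, M₀
      + j v.2)
  have hs : ∀ v, HasFDerivAt s ((ContinuousLinearMap.fst ℂ (Form N d) (Fin n → ℂ)).prod
      (j.comp (ContinuousLinearMap.snd ℂ (Form N d) (Fin n → ℂ)))) v := by
    intro v
    have h1 := (j.comp (ContinuousLinearMap.snd ℂ (Form N d) (Fin n → ℂ))).hasFDerivAt (x := v)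
    exact hasFDerivAt_fst.prodMk (h1.const_add M₀)
  have hsa : ∀ v, AnalyticAt ℂ s v := fun v =>
    analyticAt_fst.prod (analyticAt_const.add
      ((j.comp (ContinuousLinearMap.snd ℂ (Form N d) (Fin n → ℂ))).analyticAt v))
  have hs0 : s (c₀, 0) = (c₀, M₀) := by simp [s]
  have hRs : ∀ v, AnalyticAt ℂ (R ∘ s) v := fun v => (Form.analyticAt_pullback (s v)).comp (hsa v)
  have hRs' : ∀ G A, fderiv ℂ (R ∘ s) (c₀, 0) (G, A) = Form.pullback M₀ G + D (j A) := by
    intro G A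
    have h1 := (Form.hasFDerivAt_pullback (s (c₀, 0))).comp (c₀, (0 : Fin n → ℂ)) (hs (c₀, 0))
    have h2 := h1.fderiv
    change fderiv ℂ (R ∘ s) (c₀, 0) = _ at h2
    rw [h2, hs0, ContinuousLinearMap.comp_apply]
    exact Form.fderiv_pullback_apply c₀ M₀ G (j A)
  let f : Form N d × (Fin n → ℂ) → (Fin n → ℂ) := π₁ ∘ R ∘ s
  have hfa : AnalyticAt ℂ f (c₀, 0) := (π₁.analyticAt _).comp (hRs _)
  have hf' : fderiv ℂ f (c₀, 0) = π₁.comp (fderiv ℂ (R ∘ s) (c₀, 0)) :=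
    (π₁.hasFDerivAt.comp _ (hRs (c₀, 0)).differentiableAt.hasFDerivAt).fderiv
  have hinv : (fderiv ℂ f (c₀, 0) ∘L .inr ℂ (Form N d) (Fin n → ℂ)).IsInvertible := by
    have : fderiv ℂ f (c₀, 0) ∘L .inr ℂ (Form N d) (Fin n → ℂ) = ContinuousLinearMap.id ℂ (Fin n →
        ℂ) := by
      ext1 A
      rw [hf', ContinuousLinearMap.comp_apply, ContinuousLinearMap.comp_apply,
        ContinuousLinearMap.inr_apply, hRs', map_zero, zero_add, hπ₁]
      rfl
    rw [this]
    exact ⟨ContinuousLinearEquiv.refl ℂ (Fin n → ℂ), rfl⟩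
  have hcd : ContDiffAt ℂ ⊤ f (c₀, 0) := hfa.contDiffAt
  have hf0 : f (c₀, 0) = 0 := by
    change π₁ (R (s (c₀, 0))) = 0
    rw [hs0]
    change π₁ (Form.pullback M₀ c₀) = 0
    rw [hc₀, map_zero]
  let α := hcd.implicitFunction (by simp) hinv
  have hα0 : α c₀ = 0 := hcd.implicitFunction_apply_self (by simp) hinv
  have hαa : AnalyticAt ℂ α c₀ := by
    have : ContDiffAt ℂ ⊤ α c₀ := hcd.contDiffAt_implicitFunction (by simp) hinv
    exact this.analyticAt
  have hα : ∀ᶠ c in 𝓝 c₀, f (c, α c) = 0 := by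
    rw [← hf0]
    exact hcd.eventually_apply_implicitFunction (by simp) hinv
  have hαiff : ∀ᶠ v in 𝓝 (c₀, (0 : Fin n → ℂ)), f v = 0 ↔ α v.1 = v.2 := by
    have h := hcd.eventually_apply_eq_iff_implicitFunction (by simp) hinv
    rwa [hf0] at h
  let σ : Form N d → Form N d × (Fin n → ℂ) := fun c => (c, α c)
  have hσ0 : σ c₀ = (c₀, 0) := by simp [σ, hα0]
  have hσa : AnalyticAt ℂ σ c₀ := analyticAt_id.prod hαa
  let g : Form N d → (Fin (Module.finrank ℂ Q) → ℂ) := π₂ ∘ (R ∘ s) ∘ σ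
  have hga : AnalyticAt ℂ g c₀ := (π₂.analyticAt _).comp ((hRs _).comp hσa)
  have hg' : ∀ G, fderiv ℂ g c₀ G = π₂ (Form.pullback M₀ G) := by
    intro G
    have h1 : HasFDerivAt σ ((ContinuousLinearMap.id ℂ _).prod (fderiv ℂ α c₀)) c₀ :=
      (hasFDerivAt_id c₀).prodMk hαa.differentiableAt.hasFDerivAt
    have h2 := ((π₂.hasFDerivAt.comp c₀
      ((hRs (σ c₀)).differentiableAt.hasFDerivAt.comp c₀ h1))).fderiv
    change fderiv ℂ g c₀ = _ at h2
    rw [h2, hσ0]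
    change π₂ (fderiv ℂ (R ∘ s) (c₀, 0) (G, fderiv ℂ α c₀ G)) = _
    rw [hRs', map_add, (hπ₂ (D _)).2 ⟨_, rfl⟩, add_zero]
  refine ⟨{c | g c = 0}, ?_, ?_, _, g, hga, ?_, ?_, EventuallyEq.rfl⟩
  · rw [nhds_prod_eq] at hαiff
    obtain ⟨pC, hpC, pA, hpA, hCA⟩ := eventually_prod_iff.1 hαiff
    have hU : ∀ᶠ A in 𝓝 0, pA (k A) := by
      have hk0 : Tendsto k (𝓝 0) (𝓝 0) := by simpa using k.continuous.tendsto 0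
      exact hk0.eventually hpA
    -- Inside this neighbourhood the zero of `f` is unique, so any plane of `S` in the hypersurface
    -- must be the one given by `α`.
    refine ⟨_, Gr.mem_nhds_of_chart hP hl hU, fun S hS hSS => ?_⟩
    have hM : ContinuousAt (fun c => M₀ + j (α c)) c₀ :=
      continuousAt_const.add (j.continuous.continuousAt.comp hαa.continuousAt)
    have hev := hM.eventually (p := fun M => ∃ L ∈ S, L.1 = LinearMap.range M.toLinearMap) (by
      simp only [hα0, map_zero, add_zero]
      exact Gr.eventually_range_mem hP hS)
    refine eventuallyEq_set.2 ?_
    filter_upwards [hsmooth, hα, hpC, hev] with c hc hαc hpc ⟨L, hLS, hL⟩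
    constructor
    · intro hgc
      refine ⟨hc, L, hLS, ?_⟩
      rw [hL]
      exact Form.pullback_eq_zero_iff.1 (hzero _ hαc hgc)
    · rintro ⟨-, L', hLS', hL'⟩
      obtain ⟨A, hAU, hlA, hA⟩ := hSS hLS'
      rw [hA] at hL'
      have h1 := Form.pullback_eq_zero_iff.2 hL'
      rw [← hjk A hlA] at h1
      have h2 : R (s (c, k A)) = 0 := h1
      have h3 : α c = k A := (hCA hpc hAU).1 (by
        change π₁ (R (s (c, k A))) = 0
        rw [h2, map_zero])
      change π₂ (R (s (c, α c))) = 0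
      rw [h3, h2, map_zero]
  · change π₂ ((R ∘ s) (σ c₀)) = 0
    rw [hσ0, Function.comp_apply, hs0]
    change π₂ (Form.pullback M₀ c₀) = 0
    rw [hc₀, map_zero]
  · intro y
    obtain ⟨w, rfl⟩ := hπ₂surj y
    obtain ⟨G, rfl⟩ := Form.pullback_surjective (d := d) (DFunLike.congr_fun hl) w
    exact ⟨G, hg' G⟩
  · ext G
    rw [LinearMap.mem_ker, Submodule.mem_comap, LinearMap.mem_range]
    exact (hπ₂ _).symm.trans (by rw [← hg']; rfl)

end LocalBranch

/-! ### Forms vanishing on a linear subspace -/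

section Vanishing

variable {N d q : ℕ}

/-- The forms that vanish on a linear subspace. -/
def vanishingForms (d : ℕ) (L : Submodule ℂ (Fin N → ℂ)) : Submodule ℂ (Form N d) where
  carrier := {c | ∀ x ∈ L, Form.evalAt x c = 0}
  add_mem' h h' x hx := by rw [map_add, h x hx, h' x hx, add_zero]
  zero_mem' x _ := map_zero _
  smul_mem' t c h x hx := by rw [map_smul, h x hx, smul_zero]

theorem ker_pullback (M : (Fin q → ℂ) →L[ℂ] (Fin N → ℂ)) :
    LinearMap.ker (Form.pullback M) = vanishingForms d (LinearMap.range M.toLinearMap) := by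
  ext c
  rw [LinearMap.mem_ker, Form.pullback_eq_zero_iff]
  rfl

/-- Project along a complement of `L` that contains a complement of `L ⊓ L'` in `L'`. In particular
`π` maps `L'` into `L ⊓ L'`. -/
theorem exists_projection {V : Type*} [AddCommGroup V] [Module ℂ V] (L L' : Submodule ℂ V) :
    ∃ π : V →ₗ[ℂ] V, (∀ x, π x ∈ L) ∧ (∀ x ∈ L, π x = x) ∧ ∀ x ∈ L', x - π x ∈ L' := by
  obtain ⟨C, hC⟩ := exists_isCompl ((L ⊓ L').comap L'.subtype)
  set C' := C.map L'.subtype with hC'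
  have hC'L' : C' ≤ L' := Submodule.map_subtype_le _ _
  have hdisj : Disjoint C' L := by
    rw [Submodule.disjoint_def]
    rintro _ ⟨y, hy, rfl⟩ hyL
    have := Submodule.disjoint_def.1 hC.disjoint y ⟨hyL, y.2⟩ hy
    rw [this, map_zero]
  obtain ⟨Q, hQ, hcompl⟩ := hdisj.exists_isCompl
  refine ⟨L.subtype ∘ₗ L.projectionOnto Q hcompl.symm, fun x => (L.projectionOnto Q _ x).2, fun x
      hx => ?_, fun x hx => ?_⟩
  · exact congrArg Subtype.val (Submodule.projectionOnto_apply_left hcompl.symm ⟨x, hx⟩)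
  · have htop : (⟨x, hx⟩ : L') ∈ ((L ⊓ L').comap L'.subtype) ⊔ C := by
      rw [hC.sup_eq_top]; trivial
    obtain ⟨y, hy, z, hz, hyz⟩ := Submodule.mem_sup.1 htop
    have hx' : x = y.1 + z.1 := congrArg Subtype.val hyz.symm
    have h1 : L.projectionOnto Q hcompl.symm y.1 = ⟨y.1, hy.1⟩ :=
      Submodule.projectionOnto_apply_left hcompl.symm ⟨y.1, hy.1⟩
    have h2 : L.projectionOnto Q hcompl.symm z.1 = 0 :=
      (Submodule.projectionOnto_apply_eq_zero_iff hcompl.symm).2 (hQ ⟨z, hz, rfl⟩)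
    have h3 : x - (L.subtype ∘ₗ L.projectionOnto Q hcompl.symm) x = z.1 := by
      rw [hx', map_add, LinearMap.comp_apply, LinearMap.comp_apply, h1, h2]
      simp
    rw [h3]
    exact z.2

/-- If `c` vanishes on `L ⊓ L'`, then `c ∘ π` agrees with `c` on `L` and vanishes on `L'`. -/
theorem vanishingForms_inf (L L' : Submodule ℂ (Fin N → ℂ)) :
    vanishingForms d (L ⊓ L') = vanishingForms d L ⊔ vanishingForms d L' := by
  apply le_antisymm
  · intro c hc
    obtain ⟨π, hπL, hπ, hπL'⟩ := exists_projection L L'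
    have hmem : ∀ x ∈ L', π x ∈ L ⊓ L' := fun x hx =>
      ⟨hπL x, by simpa using L'.sub_mem hx (hπL' x hx)⟩
    set c' := Form.pullback (LinearMap.toContinuousLinearMap π) c with hc'
    have hev : ∀ x, Form.evalAt x c' = Form.evalAt (π x) c := Form.evalAt_pullback _ c
    refine Submodule.mem_sup.2 ⟨c - c', ?_, c', ?_, sub_add_cancel _ _⟩
    · intro x hx
      rw [map_sub, hev, hπ x hx, sub_self]
    · intro x hx
      rw [hev]
      exact hc _ (hmem x hx)
  · refine sup_le ?_ ?_
    · exact fun c hc x hx => hc x hx.1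
    · exact fun c hc x hx => hc x hx.2

end Vanishing

/-! ### First order deformations of the Fermat polynomial -/

section FermatTangent

variable {N d q : ℕ}

/-- The derivative at the identity of the action of the linear maps on the Fermat polynomial. -/
noncomputable abbrev fermatDeriv (N d : ℕ) :
    ((Fin N → ℂ) →L[ℂ] (Fin N → ℂ)) →L[ℂ] Form N d :=
  Form.pullbackDeriv (fermat N d) (ContinuousLinearMap.id ℂ _)

theorem evalAt_fermatDeriv (A : (Fin N → ℂ) →L[ℂ] (Fin N → ℂ)) (x : Fin N → ℂ) :
    Form.evalAt x (fermatDeriv N d A) = d * ∑ i, x i ^ (d - 1) * A x i :=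
  Form.evalAt_pullbackDeriv_fermat _ _ _

theorem pullback_fermatDeriv (M : (Fin q → ℂ) →L[ℂ] (Fin N → ℂ))
    (A : (Fin N → ℂ) →L[ℂ] (Fin N → ℂ)) :
    Form.pullback M (fermatDeriv N d A) = Form.pullbackDeriv (fermat N d) M (A.comp M) := by
  refine Form.ext_evalAt fun z => ?_
  rw [Form.evalAt_pullback, evalAt_fermatDeriv, Form.evalAt_pullbackDeriv_fermat]
  rfl

/-- Evaluation at `e_c + t e_c'` gives two entries of `A` with weights `t` and `t ^ (d - 1)`. These
are independent functions once `d ≥ 3`, as `t = 1, 2` show; for `d = 2` the skew matrices are in the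
kernel. -/
theorem fermatDeriv_injective (hd : 3 ≤ d) : Function.Injective (fermatDeriv N d) := by
  rw [injective_iff_map_eq_zero]
  intro A hA
  have hd0 : (d : ℂ) ≠ 0 := by exact_mod_cast (by omega : d ≠ 0)
  have hd1 : d - 1 ≠ 0 := by omega
  have h : ∀ x, ∑ i, x i ^ (d - 1) * A x i = 0 := fun x => by
    have := evalAt_fermatDeriv (d := d) A x
    rw [hA, map_zero] at this
    exact (mul_eq_zero.1 this.symm).resolve_left hd0
  have hdiag : ∀ c, A (Pi.single c 1) c = 0 := fun c => by
    have := h (Pi.single c 1)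
    rw [Finset.sum_eq_single c (fun i _ hi => by simp [Pi.single_eq_of_ne hi, hd1])
      (by simp)] at this
    simpa using this
  have hoff : ∀ c c', c ≠ c' → ∀ t : ℂ,
      t * A (Pi.single c' 1) c + t ^ (d - 1) * A (Pi.single c 1) c' = 0 := by
    intro c c' hcc t
    have h1 := h (Pi.single c 1 + t • Pi.single c' 1)
    rw [Finset.sum_eq_add c c' hcc (fun i _ hi => by
      simp [Pi.single_eq_of_ne hi.1, Pi.single_eq_of_ne hi.2, hd1]) (by simp) (by simp)] at h1
    simpa [hdiag, Pi.single_eq_of_ne hcc, Pi.single_eq_of_ne hcc.symm] using h1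
  have hA0 : ∀ c c', A (Pi.single c 1) c' = 0 := by
    intro c c'
    by_cases hcc : c = c'
    · subst hcc; exact hdiag c
    have h1 := hoff c c' hcc 1
    have h2 := hoff c c' hcc 2
    have h3 : ((2 : ℂ) ^ (d - 1) - 2) * A (Pi.single c 1) c' = 0 := by
      simp only [one_pow, one_mul] at h1
      linear_combination h2 - 2 * h1
    refine (mul_eq_zero.1 h3).resolve_left ?_
    have h4 : 2 ^ 1 < 2 ^ (d - 1) := Nat.pow_lt_pow_right (by norm_num) (by omega)
    rw [← ne_eq, sub_ne_zero]
    exact_mod_cast (by omega : 2 ^ (d - 1) ≠ 2)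
  apply ContinuousLinearMap.coe_injective
  refine (Pi.basisFun ℂ (Fin N)).ext fun c => ?_
  rw [Pi.basisFun_apply]
  funext c'
  exact hA0 c c'

theorem exists_eq_add_single {n : ℕ} {f : Fin N → ℕ} (h : ∑ i, f i = n + 1) :
    ∃ (c : Fin N) (g : Fin N → ℕ), f = g + (Pi.single c 1 : Fin N → ℕ) ∧ ∑ i, g i = n := by
  obtain ⟨c, -, hc⟩ := Finset.exists_ne_zero_of_sum_ne_zero (by omega : ∑ i, f i ≠ 0)
  have hf : f = (f - Pi.single c 1) + Pi.single c 1 := by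
    funext i
    by_cases hi : i = c
    · subst hi; simp; omega
    · simp [Pi.single_eq_of_ne hi]
  refine ⟨c, f - Pi.single c 1, hf, ?_⟩
  rw [hf] at h
  simpa [Finset.sum_add_distrib] using h

theorem Form.surjective_of_monomials {X : Type*} [AddCommGroup X] [Module ℂ X]
    (f : X →ₗ[ℂ] Form q d)
    (h : ∀ i : MonomialIndex q d, ∃ x, ∀ z, Form.evalAt z (f x) = ∏ j, z j ^ i.1 j) :
    Function.Surjective f := by
  rw [← LinearMap.range_eq_top, eq_top_iff, ← (Pi.basisFun ℂ (MonomialIndex q d)).span_eq,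
    Submodule.span_le]
  rintro _ ⟨i, rfl⟩
  obtain ⟨x, hx⟩ := h i
  refine ⟨x, Form.ext_evalAt fun z => ?_⟩
  rw [hx, Form.evalAt_eq_sum, Pi.basisFun_apply, Finset.sum_eq_single i
    (fun j _ hj => by rw [Pi.single_eq_of_ne hj, zero_mul]) (by simp), Pi.single_eq_same, one_mul]

theorem prod_pow_add_single (z : Fin q → ℂ) (g : Fin q → ℕ) (c : Fin q) :
    ∏ j, z j ^ (g + (Pi.single c 1 : Fin q → ℕ)) j = (∏ j, z j ^ g j) * z c := by
  simp only [Pi.add_apply, pow_add, Finset.prod_mul_distrib]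
  congr 1
  rw [Finset.prod_eq_single c (fun j _ hj => by simp [Pi.single_eq_of_ne hj]) (by simp)]
  simp

theorem prod_pow_of_sum_eq_zero (z : Fin q → ℂ) {g : Fin q → ℕ} (h : ∑ j, g j = 0) :
    ∏ j, z j ^ g j = 1 := by
  refine Finset.prod_eq_one fun j hj => ?_
  rw [Finset.sum_eq_zero_iff.1 h j hj, pow_zero]

theorem pullbackDeriv_fermat_one_surjective (hN : 0 < N) (M : (Fin q → ℂ) →L[ℂ] (Fin N → ℂ)) :
    Function.Surjective (Form.pullbackDeriv (fermat N 1) M) := by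
  refine Form.surjective_of_monomials (Form.pullbackDeriv (fermat N 1) M).toLinearMap fun i => ?_
  obtain ⟨c, g, hi, hg⟩ := exists_eq_add_single (Finset.mem_piAntidiag.1 i.2).1
  refine ⟨(ContinuousLinearMap.proj (R := ℂ) (φ := fun _ : Fin q => ℂ) c).smulRight
    (Pi.single (⟨0, hN⟩ : Fin N) (1 : ℂ)), fun z => ?_⟩
  rw [hi, prod_pow_add_single, prod_pow_of_sum_eq_zero z hg, ContinuousLinearMap.coe_coe,
    Form.evalAt_pullbackDeriv_fermat]
  simp [← Finset.mul_sum]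

theorem fermatDeriv_two_surjective : Function.Surjective (fermatDeriv N 2) := by
  refine Form.surjective_of_monomials (fermatDeriv N 2).toLinearMap fun i => ?_
  obtain ⟨c, f, hi, hf⟩ := exists_eq_add_single (Finset.mem_piAntidiag.1 i.2).1
  obtain ⟨c', g, rfl, hg⟩ := exists_eq_add_single hf
  refine ⟨(ContinuousLinearMap.proj (R := ℂ) (φ := fun _ : Fin N => ℂ) c').smulRight
    (Pi.single c (1 / 2 : ℂ)), fun z => ?_⟩
  rw [hi, prod_pow_add_single, prod_pow_add_single, prod_pow_of_sum_eq_zero z hg,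
    ContinuousLinearMap.coe_coe, evalAt_fermatDeriv, Finset.sum_eq_single c
    (fun j _ hj => by simp [Pi.single_eq_of_ne hj]) (by simp)]
  simp
  ring

/-! ### Subspaces with a basis of disjointly supported vectors. -/

/-- A matrix whose columns are non-zero and have disjoint supports. -/
structure Matrix.HasDisjointColumns (u : Matrix (Fin N) (Fin q) ℂ) : Prop where
  disjoint : ∀ i c c', c ≠ c' → u i c = 0 ∨ u i c' = 0
  exists_ne_zero : ∀ c, ∃ i, u i c ≠ 0

/-- A matrix as a continuous linear map. -/
noncomputable def Matrix.toCLM (u : Matrix (Fin N) (Fin q) ℂ) :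
    (Fin q → ℂ) →L[ℂ] (Fin N → ℂ) :=
  LinearMap.toContinuousLinearMap u.mulVecLin

theorem Matrix.toCLM_apply (u : Matrix (Fin N) (Fin q) ℂ) (z : Fin q → ℂ) (i : Fin N) :
    u.toCLM z i = ∑ c, u i c * z c := rfl

/-- The linear forms that the columns of a matrix define, with the entries raised to a power. -/
noncomputable def Matrix.polarCLM (u : Matrix (Fin N) (Fin q) ℂ) (e : ℕ) :
    (Fin N → ℂ) →L[ℂ] (Fin q → ℂ) :=
  Matrix.toCLM (u.map fun t => t ^ e).transpose

theorem Matrix.polarCLM_apply (u : Matrix (Fin N) (Fin q) ℂ) (e : ℕ) (v : Fin N → ℂ) (c : Fin q) :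
    u.polarCLM e v c = ∑ i, u i c ^ e * v i := rfl

namespace Matrix.HasDisjointColumns

variable {u : Matrix (Fin N) (Fin q) ℂ} (hu : u.HasDisjointColumns)
include hu

/-- Each row has at most one nonzero entry, so the power has no cross terms. -/
theorem sum_mul_pow {e : ℕ} (he : e ≠ 0) (z : Fin q → ℂ) (i : Fin N) :
    (∑ c, u i c * z c) ^ e = ∑ c, u i c ^ e * z c ^ e := by
  by_cases h : ∃ c, u i c ≠ 0
  · obtain ⟨c, hc⟩ := h
    have h0 : ∀ c', c' ≠ c → u i c' = 0 := fun c' hc' =>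
      (hu.disjoint i c' c hc').resolve_right hc
    rw [Finset.sum_eq_single c (fun c' _ hc' => by rw [h0 c' hc', zero_mul]) (by simp),
      Finset.sum_eq_single c (fun c' _ hc' => by rw [h0 c' hc', zero_pow he, zero_mul]) (by simp),
      mul_pow]
  · push Not at h
    simp [h, he]

theorem toCLM_apply_eq {c : Fin q} {i : Fin N} (h : u i c ≠ 0) (z : Fin q → ℂ) :
    u.toCLM z i = u i c * z c := by
  rw [toCLM_apply, Finset.sum_eq_single c _ (by simp)]
  intro c' _ hc'
  rw [(hu.disjoint i c' c hc').resolve_right h, zero_mul]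

theorem toCLM_injective : Function.Injective u.toCLM := by
  intro z w h
  funext c
  obtain ⟨i, hi⟩ := hu.exists_ne_zero c
  have := congrFun h i
  rw [hu.toCLM_apply_eq hi, hu.toCLM_apply_eq hi] at this
  exact mul_left_cancel₀ hi this

theorem exists_leftInverse : ∃ l : (Fin N → ℂ) →L[ℂ] (Fin q → ℂ),
    l.comp u.toCLM = ContinuousLinearMap.id ℂ _ := by
  obtain ⟨l, hl⟩ := LinearMap.exists_leftInverse_of_injective u.toCLM.toLinearMap
    (LinearMap.ker_eq_bot.2 hu.toCLM_injective)
  exact ⟨LinearMap.toContinuousLinearMap l, ContinuousLinearMap.coe_injective hl⟩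

theorem finrank_range : Module.finrank ℂ (LinearMap.range u.toCLM.toLinearMap) = q := by
  rw [LinearMap.finrank_range_of_inj hu.toCLM_injective, Module.finrank_fin_fun]

theorem sum_pow_mul {e : ℕ} (he : e ≠ 0) (z : Fin q → ℂ) (v : Fin N → ℂ) :
    ∑ i, u.toCLM z i ^ e * v i = ∑ c, z c ^ e * u.polarCLM e v c := by
  simp only [toCLM_apply, polarCLM_apply, hu.sum_mul_pow he, Finset.sum_mul, Finset.mul_sum]
  rw [Finset.sum_comm]
  refine Finset.sum_congr rfl fun c _ => Finset.sum_congr rfl fun i _ => ?_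
  ring

theorem polarCLM_surjective (e : ℕ) (he : e ≠ 0) : Function.Surjective (u.polarCLM e) := by
  intro w
  choose σ hσ using hu.exists_ne_zero
  -- Supported on one chosen row per column; disjointness kills the cross terms.
  refine ⟨fun i => ∑ c, if σ c = i then w c / u i c ^ e else 0, ?_⟩
  funext c
  rw [polarCLM_apply]
  simp only [Finset.mul_sum]
  rw [Finset.sum_comm, Finset.sum_eq_single c _ (by simp)]
  · simp only [mul_ite, mul_zero, Finset.sum_ite_eq, Finset.mem_univ, if_true]
    exact mul_div_cancel₀ _ (pow_ne_zero _ (hσ c))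
  · intro c' _ hc'
    simp only [mul_ite, mul_zero, Finset.sum_ite_eq, Finset.mem_univ, if_true]
    rw [(hu.disjoint (σ c') c' c hc').resolve_left (hσ c'), zero_pow he, zero_mul]

theorem finrank_ker_polarCLM (e : ℕ) (he : e ≠ 0) :
    Module.finrank ℂ (LinearMap.ker (u.polarCLM e).toLinearMap) + q = N := by
  have := LinearMap.finrank_range_add_finrank_ker (u.polarCLM e).toLinearMap
  rw [LinearMap.range_eq_top.2 (hu.polarCLM_surjective e he), finrank_top, Module.finrank_fin_fun,
    Module.finrank_fin_fun] at this
  omega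

theorem pullbackDeriv_fermat (hd : 2 ≤ d) (A : (Fin q → ℂ) →L[ℂ] (Fin N → ℂ)) :
    Form.pullbackDeriv (fermat N d) u.toCLM A = fermatDeriv q d ((u.polarCLM (d - 1)).comp A) := by
  refine Form.ext_evalAt fun z => ?_
  rw [evalAt_fermatDeriv, Form.evalAt_pullbackDeriv_fermat, hu.sum_pow_mul (by omega)]
  rfl

theorem exists_polar_comp (hd : 2 ≤ d) (B : (Fin q → ℂ) →L[ℂ] (Fin q → ℂ)) :
    ∃ A : (Fin N → ℂ) →L[ℂ] (Fin N → ℂ), (u.polarCLM (d - 1)).comp (A.comp u.toCLM) = B := by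
  obtain ⟨l, hl⟩ := hu.exists_leftInverse
  obtain ⟨s, hs⟩ := LinearMap.exists_rightInverse_of_surjective (u.polarCLM (d - 1)).toLinearMap
    (LinearMap.range_eq_top.2 (hu.polarCLM_surjective _ (by omega)))
  refine ⟨(LinearMap.toContinuousLinearMap s).comp (B.comp l), ?_⟩
  ext1 z
  have h1 := DFunLike.congr_fun hl z
  have h2 := DFunLike.congr_fun hs (B z)
  simp at h1 h2
  simp [h1, h2]

theorem range_pullbackDeriv_fermat (hd : 2 ≤ d) :
    LinearMap.range (Form.pullbackDeriv (fermat N d) u.toCLM).toLinearMap =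
      LinearMap.range (fermatDeriv q d).toLinearMap := by
  apply le_antisymm
  · rintro _ ⟨A, rfl⟩
    exact ⟨_, (hu.pullbackDeriv_fermat hd A).symm⟩
  · rintro _ ⟨B, rfl⟩
    obtain ⟨A, rfl⟩ := hu.exists_polar_comp hd B
    exact ⟨_, hu.pullbackDeriv_fermat hd _⟩

end Matrix.HasDisjointColumns

/-- The first order deformations of the Fermat polynomial to which the range of a linear map
deforms as a subspace of the hypersurface. -/
noncomputable def tangentForms (d : ℕ) (M : (Fin q → ℂ) →L[ℂ] (Fin N → ℂ)) :
    Submodule ℂ (Form N d) :=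
  (LinearMap.range (Form.pullbackDeriv (fermat N d) M).toLinearMap).comap (Form.pullback M)

namespace Matrix.HasDisjointColumns

variable {u : Matrix (Fin N) (Fin q) ℂ} (hu : u.HasDisjointColumns)
include hu

/-- Any first order change of the restriction of the Fermat form caused by moving the subspace is
also caused by an ambient coordinate change. Subtracting the latter from a tangent form leaves one
vanishing on the subspace. -/
theorem tangentForms_eq_sup (hd : 2 ≤ d) :
    tangentForms d u.toCLM = vanishingForms d (LinearMap.range u.toCLM.toLinearMap) ⊔
      LinearMap.range (fermatDeriv N d).toLinearMap := by
  rw [← ker_pullback]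
  apply le_antisymm
  · intro G hG
    rw [tangentForms, hu.range_pullbackDeriv_fermat hd] at hG
    obtain ⟨B, hB⟩ := hG
    obtain ⟨A, rfl⟩ := hu.exists_polar_comp hd B
    refine Submodule.mem_sup.2 ⟨G - fermatDeriv N d A, ?_, _, ⟨A, rfl⟩, sub_add_cancel _ _⟩
    rw [LinearMap.mem_ker, map_sub, pullback_fermatDeriv, hu.pullbackDeriv_fermat hd, ← hB]
    exact sub_self _
  · refine sup_le ?_ ?_
    · intro G hG
      rw [tangentForms, Submodule.mem_comap, LinearMap.mem_ker.1 hG]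
      exact Submodule.zero_mem _
    · rintro _ ⟨A, rfl⟩
      exact ⟨A.comp u.toCLM, (pullback_fermatDeriv _ _).symm⟩

theorem finrank_tangentForms (hd : 3 ≤ d) :
    Module.finrank ℂ (tangentForms d u.toCLM) + q.multichoose d = N.multichoose d + q ^ 2 := by
  rw [tangentForms, hu.range_pullbackDeriv_fermat (by omega)]
  set R := LinearMap.range (fermatDeriv q d).toLinearMap with hR
  have h1 : R.comap (Form.pullback u.toCLM) =
      LinearMap.ker (R.mkQ ∘ₗ (Form.pullback u.toCLM : Form N d →ₗ[ℂ] Form q d)) := by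
    rw [LinearMap.ker_comp, Submodule.ker_mkQ]
  obtain ⟨l, hl⟩ := hu.exists_leftInverse
  have h2 := LinearMap.finrank_range_add_finrank_ker
    (R.mkQ ∘ₗ (Form.pullback u.toCLM : Form N d →ₗ[ℂ] Form q d))
  have hsurj : Function.Surjective
      (R.mkQ ∘ₗ (Form.pullback u.toCLM : Form N d →ₗ[ℂ] Form q d)) :=
    Function.Surjective.comp (g := R.mkQ) R.mkQ_surjective
      (Form.pullback_surjective (DFunLike.congr_fun hl))
  rw [LinearMap.range_eq_top.2 hsurj, finrank_top, Form.finrank_eq, ← h1] at h2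
  have h3 := R.finrank_quotient_add_finrank
  have h4 : Module.finrank ℂ R = q ^ 2 := by
    rw [hR, LinearMap.finrank_range_of_inj (fermatDeriv_injective hd),
      ← (LinearMap.toContinuousLinearMap (𝕜 := ℂ) (E := Fin q → ℂ) (F' := Fin q → ℂ)).finrank_eq,
      Module.finrank_linearMap, Module.finrank_fin_fun, sq]
  rw [Form.finrank_eq, h4] at h3
  omega

end Matrix.HasDisjointColumns

end FermatTangent

/-! ### Tangent spaces for linear subspaces of the Fermat hypersurface. -/

section FermatSubspaces

variable {N d q r : ℕ}

/-- Differentiate the identity `F (x + t v) = 0` at `t = 0`. -/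
theorem sum_pow_mul_eq_zero (hd : d ≠ 0) {L : Submodule ℂ (Fin N → ℂ)}
    (hL : fermat N d ∈ vanishingForms d L) {x v : Fin N → ℂ} (hx : x ∈ L) (hv : v ∈ L) :
    ∑ i, x i ^ (d - 1) * v i = 0 := by
  have h4 : HasDerivAt (fun t : ℂ => ∑ i, (x i + t * v i) ^ d)
      (d * ∑ i, x i ^ (d - 1) * v i) 0 := by
    rw [Finset.mul_sum]
    refine HasDerivAt.fun_sum fun i _ => ?_
    have := ((((hasDerivAt_id (0 : ℂ)).mul_const (v i)).const_add (x i))).fun_pow d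
    simpa [mul_assoc] using this
  have h5 : (fun t : ℂ => ∑ i, (x i + t * v i) ^ d) = fun _ => 0 := by
    funext t
    have := hL (x + t • v) (L.add_mem hx (L.smul_mem t hv))
    rw [Form.evalAt_fermat] at this
    exact this
  rw [h5] at h4
  have h6 := h4.unique (hasDerivAt_const _ _)
  exact (mul_eq_zero.1 h6).resolve_left (Nat.cast_ne_zero.2 hd)

namespace Matrix.HasDisjointColumns

variable {u : Matrix (Fin N) (Fin q) ℂ} (hu : u.HasDisjointColumns)
include hu

theorem le_ker_polarCLM (hd : 3 ≤ d) {L : Submodule ℂ (Fin N → ℂ)}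
    (hL : fermat N d ∈ vanishingForms d L) (huL : LinearMap.range u.toCLM.toLinearMap ≤ L) :
    L ≤ LinearMap.ker (u.polarCLM (d - 1)).toLinearMap := by
  intro v hv
  rw [LinearMap.mem_ker]
  funext c
  have h := hu.sum_pow_mul (e := d - 1) (by omega) (Pi.single c 1) v
  have h0 := sum_pow_mul_eq_zero (by omega) hL (huL ⟨Pi.single c 1, rfl⟩) hv
  rw [ContinuousLinearMap.coe_coe] at h0
  rw [h0, Finset.sum_eq_single c
    (fun c' _ hc' => by rw [Pi.single_eq_of_ne hc', zero_pow (by omega), zero_mul]) (by simp)] at h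
  simpa using h.symm

theorem pullbackDeriv_fermat_eq_zero_iff (hd : 3 ≤ d) (A : (Fin q → ℂ) →L[ℂ] (Fin N → ℂ)) :
    Form.pullbackDeriv (fermat N d) u.toCLM A = 0 ↔
      LinearMap.range A.toLinearMap ≤ LinearMap.ker (u.polarCLM (d - 1)).toLinearMap := by
  rw [hu.pullbackDeriv_fermat (by omega), map_eq_zero_iff _ (fermatDeriv_injective hd),
    LinearMap.range_le_ker_iff]
  exact ⟨fun h => congrArg ContinuousLinearMap.toLinearMap h, fun h =>
      ContinuousLinearMap.coe_injective h⟩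

/-- The subspace lies in this kernel, and in half the ambient dimension both have dimension `q`.
This is what makes the plane in a nearby hypersurface unique. -/
theorem ker_polarCLM_eq_range (hd : 3 ≤ d)
    (hF : fermat N d ∈ vanishingForms d (LinearMap.range u.toCLM.toLinearMap)) (hN : N = 2 * q) :
    LinearMap.ker (u.polarCLM (d - 1)).toLinearMap = LinearMap.range u.toCLM.toLinearMap := by
  refine (Submodule.eq_of_le_of_finrank_eq (hu.le_ker_polarCLM hd hF le_rfl) ?_).symm
  have := hu.finrank_ker_polarCLM (d - 1) (by omega)
  rw [hu.finrank_range]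
  omega

theorem pullbackDeriv_fermat_eq_zero_iff_exists (hd : 3 ≤ d)
    (hF : fermat N d ∈ vanishingForms d (LinearMap.range u.toCLM.toLinearMap)) (hN : N = 2 * q)
    (A : (Fin q → ℂ) →L[ℂ] (Fin N → ℂ)) :
    Form.pullbackDeriv (fermat N d) u.toCLM A = 0 ↔
      ∃ B : (Fin q → ℂ) →L[ℂ] (Fin q → ℂ), A = u.toCLM.comp B := by
  rw [hu.pullbackDeriv_fermat_eq_zero_iff hd, hu.ker_polarCLM_eq_range hd hF hN]
  constructor
  · intro h
    obtain ⟨l, hl⟩ := hu.exists_leftInverse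
    refine ⟨l.comp A, ?_⟩
    ext1 z
    obtain ⟨w, hw⟩ := h ⟨z, rfl⟩
    have hlw : l (u.toCLM w) = w := DFunLike.congr_fun hl w
    change u.toCLM w = A z at hw
    change A z = u.toCLM (l (A z))
    rw [← hw, hlw]
  · rintro ⟨B, rfl⟩ _ ⟨z, rfl⟩
    exact ⟨B z, rfl⟩

end Matrix.HasDisjointColumns

/-- Write `G = a + δA = a' + δA'` with `δ = fermatDeriv`, `a ∈ I(L)`, `a' ∈ I(L')`. It suffices to
find one `B` such that `A - B` preserves `L` and `A' - B` preserves `L'`, for then `G - δB` vanishes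
on both. Since `δ(A - A')` vanishes on `L ⊓ L'`, the map `A - A'` sends `L ⊓ L'` into `L ⊔ L'`,
which is the only obstruction. -/
theorem tangentForms_inf_le (hd : 3 ≤ d) {u u' : Matrix (Fin N) (Fin r) ℂ}
    {w : Matrix (Fin N) (Fin q) ℂ} (hu : u.HasDisjointColumns) (hu' : u'.HasDisjointColumns)
    (hw : w.HasDisjointColumns) (hN : N = 2 * r)
    (hF : fermat N d ∈ vanishingForms d (LinearMap.range u.toCLM.toLinearMap))
    (hF' : fermat N d ∈ vanishingForms d (LinearMap.range u'.toCLM.toLinearMap))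
    (hinf : LinearMap.range w.toCLM.toLinearMap =
      LinearMap.range u.toCLM.toLinearMap ⊓ LinearMap.range u'.toCLM.toLinearMap) :
    tangentForms d u.toCLM ⊓ tangentForms d u'.toCLM ≤
      (vanishingForms d (LinearMap.range u.toCLM.toLinearMap) ⊓
        vanishingForms d (LinearMap.range u'.toCLM.toLinearMap)) ⊔
      LinearMap.range (fermatDeriv N d).toLinearMap := by
  rw [hu.tangentForms_eq_sup (by omega), hu'.tangentForms_eq_sup (by omega)]
  have hfr := hu.finrank_range
  have hfr' := hu'.finrank_range
  have hfw := hw.finrank_range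
  -- Both sides have dimension `2 * r - q`.
  have hker : LinearMap.ker (w.polarCLM (d - 1)).toLinearMap =
      LinearMap.range u.toCLM.toLinearMap ⊔ LinearMap.range u'.toCLM.toLinearMap := by
    refine (Submodule.eq_of_le_of_finrank_eq (sup_le
      (hw.le_ker_polarCLM hd hF (hinf.le.trans inf_le_left))
      (hw.le_ker_polarCLM hd hF' (hinf.le.trans inf_le_right))) ?_).symm
    have h1 := Submodule.finrank_sup_add_finrank_inf_eq (LinearMap.range u.toCLM.toLinearMap)
      (LinearMap.range u'.toCLM.toLinearMap)
    have h2 := hw.finrank_ker_polarCLM (d - 1) (by omega)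
    rw [← hinf] at h1
    omega
  set L := LinearMap.range u.toCLM.toLinearMap
  set L' := LinearMap.range u'.toCLM.toLinearMap
  rintro G ⟨hG, hG'⟩
  obtain ⟨a, ha, _, ⟨A, rfl⟩, hGA⟩ := Submodule.mem_sup.1 hG
  obtain ⟨a', ha', _, ⟨A', rfl⟩, hGA'⟩ := Submodule.mem_sup.1 hG'
  rw [ContinuousLinearMap.coe_coe] at hGA hGA'
  obtain ⟨p, hpL, hp, hpL'⟩ := exists_projection L L'
  let π := LinearMap.toContinuousLinearMap p
  have hmaps : ∀ x ∈ L ⊓ L', (A - A') x ∈ L ⊔ L' := by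
    intro x hx
    rw [← hinf] at hx
    obtain ⟨z, rfl⟩ := hx
    have h1 : Form.pullback w.toCLM (fermatDeriv N d (A - A')) = 0 := by
      have h2 : fermatDeriv N d (A - A') = a' - a := by
        rw [map_sub, sub_eq_sub_iff_add_eq_add, add_comm, hGA, hGA']
      rw [h2, ← LinearMap.mem_ker, ker_pullback, hinf]
      exact fun y hy => by rw [map_sub, ha' y hy.2, ha y hy.1, sub_self]
    rw [pullback_fermatDeriv, hw.pullbackDeriv_fermat_eq_zero_iff hd, hker] at h1
    exact h1 ⟨z, rfl⟩
  -- With `E = A - A'`, this gives `A - B = p E` on `L`, and `A' - B = -(1 - p) E p` everywhere. On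
  -- `L'` the latter passes through `L ⊓ L'` and `L ⊔ L'`, and `1 - p` maps `L ⊔ L'` into `L'`.
  obtain ⟨B, hB⟩ : ∃ B : (Fin N → ℂ) →L[ℂ] (Fin N → ℂ),
      ∀ x, B x = A x - p ((A - A') (p x)) - (A - A') (x - p x) :=
    ⟨A - π.comp ((A - A').comp π) - (A - A').comp (ContinuousLinearMap.id ℂ _ - π), fun x => rfl⟩
  refine Submodule.mem_sup.2 ⟨G - fermatDeriv N d B, ⟨?_, ?_⟩, _, ⟨B, rfl⟩, sub_add_cancel _ _⟩
  · intro x hx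
    have h1 : G - fermatDeriv N d B = a + fermatDeriv N d (A - B) := by
      rw [← hGA, map_sub, add_sub_assoc]
    rw [h1, map_add, ha x hx, zero_add, evalAt_fermatDeriv]
    have h2 : (A - B) x = p ((A - A') x) := by
      change A x - B x = _
      rw [hB, hp x hx, sub_self, map_zero]
      abel
    rw [h2, sum_pow_mul_eq_zero (by omega) hF hx (hpL _), mul_zero]
  · intro x hx
    have h1 : G - fermatDeriv N d B = a' + fermatDeriv N d (A' - B) := by
      rw [← hGA', map_sub, add_sub_assoc]
    rw [h1, map_add, ha' x hx, zero_add, evalAt_fermatDeriv]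
    have h2 : (A' - B) x = -((A - A') (p x) - p ((A - A') (p x))) := by
      change A' x - B x = _
      rw [hB, map_sub]
      simp only [sub_apply]
      abel
    have hpx : p x ∈ L ⊓ L' := ⟨hpL x, by simpa using L'.sub_mem hx (hpL' x hx)⟩
    have h3 : (A' - B) x ∈ L' := by
      rw [h2]
      obtain ⟨y, hy, y', hy', hyy⟩ := Submodule.mem_sup.1 (hmaps _ hpx)
      rw [← hyy, map_add, hp y hy]
      have : y + y' - (y + p y') = y' - p y' := by abel
      rw [this]
      exact L'.neg_mem (hpL' y' hy')
    rw [sum_pow_mul_eq_zero (by omega) hF' hx h3, mul_zero]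

theorem finrank_tangentForms_inf (hd : 3 ≤ d) {u u' : Matrix (Fin N) (Fin r) ℂ}
    {w : Matrix (Fin N) (Fin q) ℂ} (hu : u.HasDisjointColumns) (hu' : u'.HasDisjointColumns)
    (hw : w.HasDisjointColumns)
    (hinf : LinearMap.range w.toCLM.toLinearMap =
      LinearMap.range u.toCLM.toLinearMap ⊓ LinearMap.range u'.toCLM.toLinearMap) :
    tangentForms d u.toCLM ⊔ tangentForms d u'.toCLM = tangentForms d w.toCLM ∧
    (Module.finrank ℂ ↥(tangentForms d u.toCLM ⊓ tangentForms d u'.toCLM) : ℤ) =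
      N.multichoose d - 2 * (r.multichoose d - r ^ 2) + (q.multichoose d - q ^ 2) := by
  have hsup : tangentForms d u.toCLM ⊔ tangentForms d u'.toCLM = tangentForms d w.toCLM := by
    rw [hu.tangentForms_eq_sup (by omega), hu'.tangentForms_eq_sup (by omega),
      hw.tangentForms_eq_sup (by omega), hinf, vanishingForms_inf, sup_sup_sup_comm, sup_idem]
  refine ⟨hsup, ?_⟩
  have h1 := Submodule.finrank_sup_add_finrank_inf_eq (tangentForms d u.toCLM)
    (tangentForms d u'.toCLM)
  rw [hsup] at h1
  have h2 := hu.finrank_tangentForms hd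
  have h3 := hu'.finrank_tangentForms hd
  have h4 := hw.finrank_tangentForms hd
  zify at h1 h2 h3 h4
  linarith

end FermatSubspaces

/-! ### Manifolds inside the intersection of two branches. -/

section Manifolds

variable {N d r : ℕ}

/-- A form vanishing on `P`, composed with an invertible `g`, vanishes on `g⁻¹ P`, which is close to
`P` when `g` is close to the identity. -/
theorem IsLocalBranch.eventually_pullback_mem {P : Gr r N} {c₀ : Form N d} {V : Set (Form N d)}
    (hV : IsLocalBranch P c₀ V) (hsmooth : ∀ᶠ c in 𝓝 c₀, c.IsSmooth)
    {p : Form N d →L[ℂ] Form N d} (hp : ∀ c, p c ∈ vanishingForms d P.1) (hp₀ : p c₀ = c₀)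
    {M : (Fin r → ℂ) →L[ℂ] (Fin N → ℂ)} (hM : P.1 = LinearMap.range M.toLinearMap) :
    ∀ᶠ v in 𝓝 (c₀, ContinuousLinearMap.id ℂ (Fin N → ℂ)), Form.pullback v.2 (p v.1) ∈ V := by
  obtain ⟨S, hS, h⟩ := hV
  have hVS := h S hS le_rfl
  have hid : Form.pullback (ContinuousLinearMap.id ℂ (Fin N → ℂ)) c₀ = c₀ :=
    Form.ext_evalAt fun x => Form.evalAt_pullback _ _ _
  have hc : ContinuousAt (fun v : Form N d × ((Fin N → ℂ) →L[ℂ] (Fin N → ℂ)) =>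
      Form.pullback v.2 (p v.1)) (c₀, ContinuousLinearMap.id ℂ (Fin N → ℂ)) := by
    have h1 : ContinuousAt (fun v : Form N d × ((Fin N → ℂ) →L[ℂ] (Fin N → ℂ)) => (p v.1, v.2))
      (c₀, ContinuousLinearMap.id ℂ (Fin N → ℂ)) := by fun_prop
    exact ContinuousAt.comp (f := fun v : Form N d × ((Fin N → ℂ) →L[ℂ] (Fin N → ℂ)) => (p v.1,
        v.2))
      (Form.analyticAt_pullback _).continuousAt h1
  have hc' : Tendsto (fun v : Form N d × ((Fin N → ℂ) →L[ℂ] (Fin N → ℂ)) =>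
      Form.pullback v.2 (p v.1)) (𝓝 (c₀, ContinuousLinearMap.id ℂ (Fin N → ℂ))) (𝓝 c₀) := by
    have := hc.tendsto
    simp only [hp₀, hid] at this
    exact this
  have hsnd : Tendsto (fun v : Form N d × ((Fin N → ℂ) →L[ℂ] (Fin N → ℂ)) => v.2)
      (𝓝 (c₀, ContinuousLinearMap.id ℂ (Fin N → ℂ))) (𝓝 1) := continuous_snd.tendsto _
  have hinv : Tendsto (fun v : Form N d × ((Fin N → ℂ) →L[ℂ] (Fin N → ℂ)) =>
      (Ring.inverse v.2).comp M) (𝓝 (c₀, ContinuousLinearMap.id ℂ (Fin N → ℂ))) (𝓝 M) := by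
    have h1 := (NormedRing.inverse_continuousAt (1 : ((Fin N → ℂ) →L[ℂ] (Fin N → ℂ))ˣ)).tendsto
    rw [Units.val_one, Ring.inverse_one] at h1
    have h2 : Tendsto (fun g : (Fin N → ℂ) →L[ℂ] (Fin N → ℂ) => g.comp M) (𝓝 1) (𝓝 M) := by
      have h3 : Continuous (fun g : (Fin N → ℂ) →L[ℂ] (Fin N → ℂ) => g.comp M) := by fun_prop
      exact h3.tendsto 1
    exact h2.comp (h1.comp hsnd)
  have hunit := hsnd.eventually (Units.isOpen.mem_nhds isUnit_one)
  filter_upwards [hc'.eventually hsmooth, hc'.eventually hVS.mem_iff, hunit,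
    hinv.eventually (Gr.eventually_range_mem hM hS)] with v hsm hiff hu ⟨L, hLS, hL⟩
  refine hiff.2 ⟨hsm, L, hLS, ?_⟩
  rw [hL]
  rintro _ ⟨z, rfl⟩
  change Form.evalAt (Ring.inverse v.2 (M z)) _ = 0
  rw [Form.evalAt_pullback]
  have h1 : v.2 (Ring.inverse v.2 (M z)) = M z :=
    DFunLike.congr_fun (Ring.mul_inverse_cancel v.2 hu) (M z)
  rw [h1]
  exact hp _ _ (by rw [hM]; exact ⟨z, rfl⟩)

theorem Form.pullback_id (c : Form N d) :
    Form.pullback (ContinuousLinearMap.id ℂ (Fin N → ℂ)) c = c :=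
  Form.ext_evalAt fun x => by rw [Form.evalAt_pullback]; rfl

theorem analyticAt_pullback_comp (p : Form N d →L[ℂ] Form N d)
    (v : Form N d × ((Fin N → ℂ) →L[ℂ] (Fin N → ℂ))) :
    AnalyticAt ℂ (fun v : Form N d × ((Fin N → ℂ) →L[ℂ] (Fin N → ℂ)) =>
      Form.pullback v.2 (p v.1)) v := by
  have h1 : AnalyticAt ℂ (fun v : Form N d × ((Fin N → ℂ) →L[ℂ] (Fin N → ℂ)) => (p v.1, v.2)) v :=
    ((p.analyticAt _).fun_comp analyticAt_fst).prod analyticAt_snd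
  exact AnalyticAt.fun_comp (f := fun v : Form N d × ((Fin N → ℂ) →L[ℂ] (Fin N → ℂ)) =>
    (p v.1, v.2)) (Form.analyticAt_pullback (p v.1, v.2)) h1

theorem fderiv_pullback_comp {p : Form N d →L[ℂ] Form N d} {c₀ : Form N d} (hp : p c₀ = c₀)
    (G : Form N d) (A : (Fin N → ℂ) →L[ℂ] (Fin N → ℂ)) :
    fderiv ℂ (fun v : Form N d × ((Fin N → ℂ) →L[ℂ] (Fin N → ℂ)) => Form.pullback v.2 (p v.1))
      (c₀, ContinuousLinearMap.id ℂ (Fin N → ℂ)) (G, A) =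
      p G + Form.pullbackDeriv c₀ (ContinuousLinearMap.id ℂ (Fin N → ℂ)) A := by
  have h2 := Form.fderiv_pullback_apply c₀ (ContinuousLinearMap.id ℂ (Fin N → ℂ)) (p G) A
  rw [Form.pullback_id] at h2
  rw [← h2]
  have h3 : HasFDerivAt (fun v : Form N d × ((Fin N → ℂ) →L[ℂ] (Fin N → ℂ)) => (p v.1, v.2))
      (p.prodMap (ContinuousLinearMap.id ℂ _)) (c₀, ContinuousLinearMap.id ℂ (Fin N → ℂ)) :=
    (p.prodMap (ContinuousLinearMap.id ℂ ((Fin N → ℂ) →L[ℂ] (Fin N → ℂ)))).hasFDerivAt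
  have h4 := (Form.hasFDerivAt_pullback (p c₀, ContinuousLinearMap.id ℂ (Fin N → ℂ))).comp
    (c₀, ContinuousLinearMap.id ℂ (Fin N → ℂ)) h3
  have h5 := h4.fderiv
  rw [hp] at h5
  exact DFunLike.congr_fun h5 (G, A)

theorem containsManifoldsNear_inter_of_isLocalBranch {P P' : Gr r N} {V V' : Set (Form N d)}
    (hd : d ≠ 0) (hV : IsLocalBranch P (fermat N d) V) (hV' : IsLocalBranch P' (fermat N d) V')
    (hF : fermat N d ∈ vanishingForms d P.1) (hF' : fermat N d ∈ vanishingForms d P'.1)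
    {M M' : (Fin r → ℂ) →L[ℂ] (Fin N → ℂ)} (hM : P.1 = LinearMap.range M.toLinearMap)
    (hM' : P'.1 = LinearMap.range M'.toLinearMap) {s : ℕ}
    (hs : s ≤ Module.finrank ℂ ↥((vanishingForms d P.1 ⊓ vanishingForms d P'.1) ⊔
      LinearMap.range (fermatDeriv N d).toLinearMap)) :
    ContainsManifoldsNear (V ∩ V') (fermat N d) s := by
  obtain ⟨p, hpP, hpP', hp⟩ : ∃ p : Form N d →L[ℂ] Form N d,
      (∀ c, p c ∈ vanishingForms d P.1) ∧ (∀ c, p c ∈ vanishingForms d P'.1) ∧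
      ∀ c ∈ vanishingForms d P.1 ⊓ vanishingForms d P'.1, p c = c := by
    obtain ⟨p, hpmem, hp, -⟩ :=
      exists_projection (vanishingForms d P.1 ⊓ vanishingForms d P'.1) ⊥
    exact ⟨LinearMap.toContinuousLinearMap p, fun c => (Submodule.mem_inf.1 (hpmem c)).1,
      fun c => (Submodule.mem_inf.1 (hpmem c)).2, hp⟩
  have hpF : p (fermat N d) = fermat N d := hp _ (Submodule.mem_inf.2 ⟨hF, hF'⟩)
  have hval : Form.pullback (ContinuousLinearMap.id ℂ (Fin N → ℂ)) (p (fermat N d)) =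
      fermat N d := by rw [hpF, Form.pullback_id]
  have hsm := Form.eventually_isSmooth_fermat (N := N) hd
  have hmem : ∀ᶠ v in 𝓝 (fermat N d, ContinuousLinearMap.id ℂ (Fin N → ℂ)),
      Form.pullback v.2 (p v.1) ∈ V ∩ V' := by
    filter_upwards [hV.eventually_pullback_mem hsm hpP hpF hM,
      hV'.eventually_pullback_mem hsm hpP' hpF hM'] with v h h' using ⟨h, h'⟩
  have hle : (vanishingForms d P.1 ⊓ vanishingForms d P'.1) ⊔
      LinearMap.range (fermatDeriv N d).toLinearMap ≤ LinearMap.range (fderiv ℂ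
        (fun v : Form N d × ((Fin N → ℂ) →L[ℂ] (Fin N → ℂ)) => Form.pullback v.2 (p v.1))
        (fermat N d, ContinuousLinearMap.id ℂ (Fin N → ℂ))).toLinearMap := by
    refine sup_le ?_ ?_
    · intro G hG
      refine ⟨(G, 0), ?_⟩
      rw [ContinuousLinearMap.coe_coe, fderiv_pullback_comp hpF, map_zero, add_zero]
      exact hp G hG
    · rintro _ ⟨A, rfl⟩
      refine ⟨(0, A), ?_⟩
      rw [ContinuousLinearMap.coe_coe, fderiv_pullback_comp hpF, map_zero, zero_add]
      rfl
  have hfin := hs.trans (Submodule.finrank_mono hle)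
  have key := ContainsManifoldsNear.of_analyticAt
    (analyticAt_pullback_comp p (fermat N d, ContinuousLinearMap.id ℂ (Fin N → ℂ))) hmem hfin
  simp only [hval] at key
  exact key

end Manifolds

/-! ### Subspaces defined by binomial equations -/

section Binomial

variable {N : ℕ}

/-- Two coordinates are proportional on a subspace. -/
def coordSetoid (L : Submodule ℂ (Fin N → ℂ)) : Setoid (Fin N) where
  r i j := ∃ t : ℂ, t ≠ 0 ∧ ∀ x ∈ L, x i = t * x j
  iseqv := {
    refl i := ⟨1, one_ne_zero, fun x _ => (one_mul _).symm⟩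
    symm := by
      rintro i j ⟨t, ht, h⟩
      exact ⟨t⁻¹, inv_ne_zero ht, fun x hx => by rw [h x hx, inv_mul_cancel_left₀ ht]⟩
    trans := by
      rintro i j k ⟨t, ht, h⟩ ⟨s, hs, h'⟩
      exact ⟨t * s, mul_ne_zero ht hs, fun x hx => by rw [h x hx, h' x hx, mul_assoc]⟩ }

-- Coordinates in one class are proportional on `L`, so the restrictions of `L` to a class form at
-- most a line. As these restrictions stay in `L`, they span it; classes on which `L` vanishes are
-- discarded.
open Classical in
theorem exists_hasDisjointColumns_of_restrict {L : Submodule ℂ (Fin N → ℂ)}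
    (hL : ∀ x ∈ L, ∀ j, (fun i => if (coordSetoid L).r i j then x i else 0) ∈ L) :
    ∃ u : Matrix (Fin N) (Fin (Module.finrank ℂ L)) ℂ, u.HasDisjointColumns ∧
      LinearMap.range u.toCLM.toLinearMap = L := by
  suffices h : ∃ (q : ℕ) (u : Matrix (Fin N) (Fin q) ℂ), u.HasDisjointColumns ∧
      LinearMap.range u.toCLM.toLinearMap = L by
    obtain ⟨q, u, hu, hr⟩ := h
    have hq : q = Module.finrank ℂ L := by rw [← hr, hu.finrank_range]
    subst hq
    exact ⟨u, hu, hr⟩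
  let C := {c : Quotient (coordSetoid L) // ∃ x ∈ L, x c.out ≠ 0}
  let e : Fin (Fintype.card C) ≃ C := (Fintype.equivFin C).symm
  let rep : Fin (Fintype.card C) → Fin N := fun c => (e c).1.out
  have hrep : ∀ c c', (coordSetoid L).r (rep c) (rep c') → c = c' := fun c c' h =>
    e.injective (Subtype.ext (Quotient.out_equiv_out.1 h))
  choose y hyL hy using fun c => (e c).2
  have hrel : ∀ i, (∃ x ∈ L, x i ≠ 0) → ∃ c, (coordSetoid L).r i (rep c) := by
    rintro i ⟨x, hx, hxi⟩
    have h1 : (coordSetoid L).r i (Quotient.mk (coordSetoid L) i).out :=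
      (coordSetoid L).symm (Quotient.mk_out i)
    obtain ⟨t, ht, h⟩ := h1
    refine ⟨e.symm ⟨Quotient.mk (coordSetoid L) i, x, hx, fun h0 => hxi ?_⟩, ?_⟩
    · rw [h x hx, h0, mul_zero]
    · simp only [rep, Equiv.apply_symm_apply]
      exact ⟨t, ht, h⟩
  let u : Matrix (Fin N) (Fin (Fintype.card C)) ℂ := fun i c =>
    (y c (rep c))⁻¹ * if (coordSetoid L).r i (rep c) then y c i else 0
  have huL : ∀ c, (fun i => u i c) ∈ L := fun c => L.smul_mem _ (hL _ (hyL c) (rep c))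
  have hu1 : ∀ c, u (rep c) c = 1 := fun c => by
    have : (coordSetoid L).r (rep c) (rep c) := (coordSetoid L).refl _
    simp only [u, if_pos this]
    exact inv_mul_cancel₀ (hy c)
  have hu0 : ∀ i c, ¬ (coordSetoid L).r i (rep c) → u i c = 0 := fun i c h => by
    simp only [u, if_neg h, mul_zero]
  have hudisj : u.HasDisjointColumns := by
    refine ⟨fun i c c' hcc => ?_, fun c => ⟨rep c, by rw [hu1]; exact one_ne_zero⟩⟩
    by_contra! h
    have h1 : (coordSetoid L).r i (rep c) := by_contra fun h' => h.1 (hu0 i c h')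
    have h2 : (coordSetoid L).r i (rep c') := by_contra fun h' => h.2 (hu0 i c' h')
    exact hcc (hrep c c' ((coordSetoid L).trans ((coordSetoid L).symm h1) h2))
  refine ⟨_, u, hudisj, le_antisymm ?_ fun x hx => ⟨fun c => x (rep c), ?_⟩⟩
  · rintro _ ⟨z, rfl⟩
    have : u.toCLM z = ∑ c, z c • fun i => u i c := by
      funext i
      simp [Matrix.toCLM_apply, Finset.sum_apply, mul_comm]
    rw [ContinuousLinearMap.coe_coe, this]
    exact L.sum_mem fun c _ => L.smul_mem _ (huL c)
  · funext i
    rw [ContinuousLinearMap.coe_coe]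
    by_cases hi : ∃ x ∈ L, x i ≠ 0
    · obtain ⟨c, t, ht, h⟩ := hrel i hi
      have huic : u i c = t := by
        have := h _ (huL c)
        simpa [hu1] using this
      rw [hudisj.toCLM_apply_eq (c := c) (by rwa [huic]), huic, h x hx]
    · push Not at hi
      rw [Matrix.toCLM_apply, hi x hx]
      exact Finset.sum_eq_zero fun c _ => by rw [hi _ (huL c), zero_mul]

/-- Each equation relates two coordinates of the same class, so restricting to a class preserves all
equations. -/
theorem exists_hasDisjointColumns {ι : Type*} {L : Submodule ℂ (Fin N → ℂ)} (s t : ι → Fin N)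
    (w : ι → ℂ) (hw : ∀ k, w k ≠ 0) (hL : ∀ x, x ∈ L ↔ ∀ k, x (s k) = w k * x (t k)) :
    ∃ u : Matrix (Fin N) (Fin (Module.finrank ℂ L)) ℂ, u.HasDisjointColumns ∧
      LinearMap.range u.toCLM.toLinearMap = L := by
  classical
  refine exists_hasDisjointColumns_of_restrict fun x hx j => (hL _).2 fun k => ?_
  have hst : (coordSetoid L).r (s k) (t k) := ⟨w k, hw k, fun y hy => (hL y).1 hy k⟩
  have hiff : (coordSetoid L).r (s k) j ↔ (coordSetoid L).r (t k) j :=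
    ⟨fun h => (coordSetoid L).trans ((coordSetoid L).symm hst) h,
      fun h => (coordSetoid L).trans hst h⟩
  by_cases h : (coordSetoid L).r (t k) j
  · simp only [if_pos h, if_pos (hiff.2 h)]
    exact (hL x).1 hx k
  · simp only [if_neg h, if_neg (mt hiff.1 h), mul_zero]

end Binomial

/-! ### Linear cycles and their intersections. -/

section LinearCycles

variable {k d : ℕ}

theorem mem_linearCycleSubmodule {a : Fin (k + 1) → Fin d} {b : Equiv.Perm (Fin (2 * k + 2))}
    {x : Fin (2 * k + 2) → ℂ} : x ∈ linearCycleSubmodule a b ↔ ∀ e : Fin (k + 1),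
    x (b ⟨2 * e, by omega⟩) =
      Complex.exp (2 * Real.pi * Complex.I / (2 * d)) ^ (1 + 2 * (a e : ℕ)) *
        x (b ⟨2 * e + 1, by omega⟩) :=
  forall_congr' fun _ => sub_eq_zero

theorem exists_hasDisjointColumns_linearCycle (a : Fin (k + 1) → Fin d)
    (b : Equiv.Perm (Fin (2 * k + 2))) :
    ∃ u : Matrix (Fin (2 * k + 2)) (Fin (k + 1)) ℂ, u.HasDisjointColumns ∧
      LinearMap.range u.toCLM.toLinearMap = (linearCycle a b).1 := by
  have h := exists_hasDisjointColumns (L := (linearCycle a b).1) _ _ _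
    (fun e => pow_ne_zero _ (Complex.exp_ne_zero _)) fun x => mem_linearCycleSubmodule
  rwa [(linearCycle a b).2] at h

theorem exists_hasDisjointColumns_linearCycle_inf (a a' : Fin (k + 1) → Fin d)
    (b b' : Equiv.Perm (Fin (2 * k + 2))) :
    ∃ u : Matrix (Fin (2 * k + 2))
      (Fin (Module.finrank ℂ ↥((linearCycle a b).1 ⊓ (linearCycle a' b').1))) ℂ,
      u.HasDisjointColumns ∧
      LinearMap.range u.toCLM.toLinearMap = (linearCycle a b).1 ⊓ (linearCycle a' b').1 := by
  refine exists_hasDisjointColumns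
    (Sum.elim (fun e : Fin (k + 1) => b ⟨2 * e, by omega⟩)
      (fun e : Fin (k + 1) => b' ⟨2 * e, by omega⟩))
    (Sum.elim (fun e : Fin (k + 1) => b ⟨2 * e + 1, by omega⟩)
      (fun e : Fin (k + 1) => b' ⟨2 * e + 1, by omega⟩))
    (Sum.elim
      (fun e => Complex.exp (2 * Real.pi * Complex.I / (2 * d)) ^ (1 + 2 * (a e : ℕ)))
      (fun e => Complex.exp (2 * Real.pi * Complex.I / (2 * d)) ^ (1 + 2 * (a' e : ℕ))))
    (by rintro (e | e) <;> exact pow_ne_zero _ (Complex.exp_ne_zero _)) fun x => ?_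
  rw [Sum.forall]
  exact and_congr mem_linearCycleSubmodule mem_linearCycleSubmodule

theorem sum_fin_two_mul_add_two {M : Type*} [AddCommMonoid M] (k : ℕ)
    (f : Fin (2 * k + 2) → M) :
    ∑ i, f i = ∑ e : Fin (k + 1), (f ⟨2 * e, by omega⟩ + f ⟨2 * e + 1, by omega⟩) := by
  induction k with
  | zero => simp [Fin.sum_univ_succ]
  | succ k ih =>
    rw [Fin.sum_univ_castSucc, Fin.sum_univ_castSucc, Fin.sum_univ_castSucc (n := k + 1), add_assoc]
    congr 1
    exact ih fun i => f i.castSucc.castSucc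

theorem fermat_mem_vanishingForms (hd : d ≠ 0) (a : Fin (k + 1) → Fin d)
    (b : Equiv.Perm (Fin (2 * k + 2))) :
    fermat (2 * k + 2) d ∈ vanishingForms d (linearCycle a b).1 := by
  intro x hx
  rw [Form.evalAt_fermat, ← Equiv.sum_comp b, sum_fin_two_mul_add_two]
  refine Finset.sum_eq_zero fun e _ => ?_
  rw [mem_linearCycleSubmodule.1 hx e, mul_pow, ← pow_mul, mul_comm _ d, pow_mul,
    ← Complex.exp_nat_mul]
  -- Thus `ζ_{2d} ^ d = -1`; its odd powers are `-1`, and the two `d`-th powers in each pair cancel.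
  have h : (d : ℂ) * (2 * Real.pi * Complex.I / (2 * d)) = Real.pi * Complex.I := by
    have : (d : ℂ) ≠ 0 := Nat.cast_ne_zero.2 hd
    field_simp
  rw [h, Complex.exp_pi_mul_I, Odd.neg_one_pow (by exact ⟨a e, by ring⟩)]
  ring

end LinearCycles

/-! ### The numbers `C` as coefficients of a power series -/

section HilbertFunction

open PowerSeries

theorem cNumber_eq_sum (n d : ℕ) {s : ℕ} (a : Fin s → ℕ) :
    cNumber n d a = ∑ I : Finset (Fin s), (-1) ^ I.card *
      if ∑ i ∈ I, a i ≤ d then ((n + 1 + d - ∑ i ∈ I, a i).choose (n + 1) : ℤ) else 0 := by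
  rw [← Finset.powerset_univ, Finset.sum_powerset, Finset.card_fin, Finset.sum_range_succ',
    cNumber, Finset.powersetCard_zero, Finset.sum_singleton]
  simp only [Finset.card_empty, pow_zero, one_mul, Finset.sum_empty, zero_le, if_true, Nat.sub_zero]
  rw [add_comm (Finset.sum _ _), sub_eq_add_neg, ← Finset.sum_neg_distrib, Finset.range_eq_Ico,
    Finset.sum_Ico_add' (fun j => ∑ I ∈ Finset.powersetCard j Finset.univ, (-1) ^ I.card *
      if ∑ i ∈ I, a i ≤ d then ((n + 1 + d - ∑ i ∈ I, a i).choose (n + 1) : ℤ) else 0) 0 s 1]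
  congr 1
  refine Finset.sum_congr rfl fun j hj => ?_
  obtain ⟨hj1, -⟩ := Finset.mem_Icc.1 hj
  obtain ⟨j, rfl⟩ := Nat.exists_eq_add_of_le' hj1
  rw [Finset.sum_filter, Nat.add_sub_cancel, ← neg_mul, Finset.mul_sum]
  refine Finset.sum_congr rfl fun I hI => ?_
  rw [(Finset.mem_powersetCard.1 hI).2, pow_succ, mul_neg_one]

theorem coeff_invOneSubPow (q n : ℕ) :
    coeff n (invOneSubPow ℤ q).val = (q.multichoose n : ℤ) := by
  cases q with
  | zero =>
    rw [invOneSubPow_zero, Units.val_one, coeff_one]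
    cases n <;> simp
  | succ q =>
    rw [invOneSubPow_val_succ_eq_mk_add_choose, coeff_mk, Nat.multichoose_eq,
      show q + 1 + n - 1 = q + n by omega, Nat.choose_symm_add]

/-- The alternating sum is the expansion of the product: the Hilbert series of a complete
intersection of degrees `a i` in `n + 2` variables. -/
theorem cNumber_eq_coeff (n d : ℕ) {s : ℕ} (a : Fin s → ℕ) :
    cNumber n d a = coeff d ((∏ i, (1 - (X : ℤ⟦X⟧) ^ a i)) * (invOneSubPow ℤ (n + 2)).val) := by
  have h : ∏ i, (1 - (X : ℤ⟦X⟧) ^ a i) =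
      ∑ I : Finset (Fin s), C ((-1) ^ I.card) * X ^ ∑ i ∈ I, a i := by
    simp only [sub_eq_neg_add]
    rw [Finset.prod_add_one, Finset.powerset_univ]
    refine Finset.sum_congr rfl fun I _ => ?_
    rw [Finset.prod_neg, Finset.prod_pow_eq_pow_sum]
    simp
  rw [cNumber_eq_sum, h, Finset.sum_mul, map_sum]
  refine Finset.sum_congr rfl fun I _ => ?_
  rw [mul_assoc, coeff_C_mul, coeff_X_pow_mul']
  congr 1
  split_ifs with hI
  · rw [invOneSubPow_val_succ_eq_mk_add_choose, coeff_mk, Nat.add_sub_assoc hI]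
  · rfl

theorem cNumber_onesThen_eq_coeff {n p q : ℕ} (d : ℕ) (h : p + q = n + 2) :
    cNumber n d (onesThen d p q) =
      coeff d ((1 - (X : ℤ⟦X⟧) ^ (d - 1)) ^ q * (invOneSubPow ℤ q).val) := by
  rw [cNumber_eq_coeff, Fin.prod_univ_add]
  simp only [onesThen, Fin.append_left, Fin.append_right, Finset.prod_const, Finset.card_fin,
    pow_one]
  rw [← h, add_comm p q, ← one_sub_pow_mul_invOneSubPow_val_add_eq_invOneSubPow_val ℤ q p]
  congr 1
  ring

/-- For `d = 1` the factors `1 - X ^ 0` vanish unless `q = 0`; for `d = 2` the series is `1`. -/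
theorem cNumber_onesThen_of_le_two {n p q d : ℕ} (h : p + q = n + 2) (hd : 1 ≤ d) (hd' : d ≤ 2) :
    cNumber n d (onesThen d p q) = 0 := by
  rw [cNumber_onesThen_eq_coeff d h]
  obtain rfl | rfl : d = 1 ∨ d = 2 := by omega
  · rcases Nat.eq_zero_or_pos q with rfl | hq
    · simp [invOneSubPow_zero, coeff_one]
    · simp [hq.ne']
  · have h1 := one_sub_pow_mul_invOneSubPow_val_add_eq_invOneSubPow_val ℤ 0 q
    rw [Nat.zero_add, invOneSubPow_zero, Units.val_one] at h1
    rw [show 2 - 1 = 1 from rfl, pow_one, h1, coeff_one, if_neg (by norm_num)]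

theorem exists_one_sub_pow {R : Type*} [CommRing R] (y : R) (q : ℕ) :
    ∃ r, (1 - y) ^ q = 1 - q * y + y ^ 2 * r := by
  induction q with
  | zero => exact ⟨0, by simp⟩
  | succ q ih =>
    obtain ⟨r, hr⟩ := ih
    exact ⟨q + r - y * r, by rw [pow_succ, hr]; push_cast; ring⟩

/-- As `2 * (d - 1) > d`, only the constant and linear terms in `X ^ (d - 1)` reach degree `d`. -/
theorem cNumber_onesThen {n p q d : ℕ} (h : p + q = n + 2) (hd : 3 ≤ d) :
    cNumber n d (onesThen d p q) = q.multichoose d - q ^ 2 := by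
  rw [cNumber_onesThen_eq_coeff d h]
  obtain ⟨r, hr⟩ := exists_one_sub_pow ((X : ℤ⟦X⟧) ^ (d - 1)) q
  have h1 : (1 - (X : ℤ⟦X⟧) ^ (d - 1)) ^ q * (invOneSubPow ℤ q).val =
      (invOneSubPow ℤ q).val - C (q : ℤ) * (X ^ (d - 1) * (invOneSubPow ℤ q).val) +
        X ^ ((d - 1) * 2) * (r * (invOneSubPow ℤ q).val) := by
    rw [hr, map_natCast, pow_mul]
    ring
  rw [h1, map_add, map_sub, coeff_C_mul, coeff_X_pow_mul', coeff_X_pow_mul', if_pos (by omega),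
    if_neg (by omega), coeff_invOneSubPow, coeff_invOneSubPow, show d - (d - 1) = 1 by omega,
    Nat.multichoose_one_right]
  ring

end HilbertFunction

/-! ### The local branches of linear cycles -/

section Branches

variable {k d : ℕ}

theorem pullbackDeriv_fermat_surjective {N q : ℕ} (hN : 0 < N) (hd : 1 ≤ d) (hd' : d ≤ 2)
    {u : Matrix (Fin N) (Fin q) ℂ} (hu : u.HasDisjointColumns) :
    Function.Surjective (Form.pullbackDeriv (fermat N d) u.toCLM) := by
  obtain rfl | rfl : d = 1 ∨ d = 2 := by omega
  · exact pullbackDeriv_fermat_one_surjective hN _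
  · have h := hu.range_pullbackDeriv_fermat (d := 2) le_rfl
    rw [LinearMap.range_eq_top.2 fermatDeriv_two_surjective] at h
    exact LinearMap.range_eq_top.1 h

theorem isLocalBranch_linearCycle_univ (hd : 1 ≤ d) (hd' : d ≤ 2) (a : Fin (k + 1) → Fin d)
    (b : Equiv.Perm (Fin (2 * k + 2))) :
    IsLocalBranch (linearCycle a b) (fermat (2 * k + 2) d) Set.univ := by
  obtain ⟨u, hu, hr⟩ := exists_hasDisjointColumns_linearCycle a b
  refine ⟨Set.univ, univ_mem, fun S hS _ => ?_⟩
  refine (eventuallyEq_univ.2 (hypersurfacesContaining_mem_nhds hr.symm ?_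
    (Form.eventually_isSmooth_fermat (by omega))
    (pullbackDeriv_fermat_surjective (by omega) hd hd' hu) hS)).symm
  rw [← LinearMap.mem_ker, ker_pullback, hr]
  exact fermat_mem_vanishingForms (by omega) a b

theorem IsLocalBranch.mem_nhds_fermat (hd : 1 ≤ d) (hd' : d ≤ 2) {a : Fin (k + 1) → Fin d}
    {b : Equiv.Perm (Fin (2 * k + 2))} {V : Set (Form (2 * k + 2) d)}
    (hV : IsLocalBranch (linearCycle a b) (fermat (2 * k + 2) d) V) :
    V ∈ 𝓝 (fermat (2 * k + 2) d) :=
  eventuallyEq_univ.1 (hV.unique (isLocalBranch_linearCycle_univ hd hd' a b))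

theorem exists_isLocalBranch_linearCycle (hd : 3 ≤ d) {a : Fin (k + 1) → Fin d}
    {b : Equiv.Perm (Fin (2 * k + 2))} {u : Matrix (Fin (2 * k + 2)) (Fin (k + 1)) ℂ}
    (hu : u.HasDisjointColumns) (hr : LinearMap.range u.toCLM.toLinearMap = (linearCycle a b).1) :
    ∃ V, IsLocalBranch (linearCycle a b) (fermat (2 * k + 2) d) V ∧
      IsSubmanifoldAt V (fermat (2 * k + 2) d) (tangentForms d u.toCLM) := by
  obtain ⟨l, hl⟩ := hu.exists_leftInverse
  have hF := fermat_mem_vanishingForms (by omega) a b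
  rw [← hr] at hF
  refine exists_isLocalBranch_of_injective hr.symm ?_
    (Form.eventually_isSmooth_fermat (by omega)) hl
    (hu.pullbackDeriv_fermat_eq_zero_iff_exists hd hF (by omega))
  rwa [← LinearMap.mem_ker, ker_pullback]

theorem containsManifoldsNear_of_mem_nhds {E : Type*} [NormedAddCommGroup E] [NormedSpace ℂ E]
    [CompleteSpace E] {A : Set E} {p : E} (h : A ∈ 𝓝 p) :
    ContainsManifoldsNear A p (Module.finrank ℂ E) := by
  refine ContainsManifoldsNear.of_analyticAt (f := id) analyticAt_id h ?_
  rw [fderiv_id, LinearMap.range_eq_top.2 Function.surjective_id, finrank_top]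

theorem hasLocalDim_of_mem_nhds {E : Type*} [NormedAddCommGroup E] [NormedSpace ℂ E]
    [FiniteDimensional ℂ E] {A : Set E} {p : E} (h : A ∈ 𝓝 p) :
    HasLocalDim A p (Module.finrank ℂ E) := by
  have := FiniteDimensional.complete ℂ E
  refine ⟨containsManifoldsNear_of_mem_nhds h, fun s hs => ?_⟩
  rw [← Set.inter_self A] at hs
  exact (hs.le_finrank_inf (isSubmanifoldAt_of_mem_nhds h) (isSubmanifoldAt_of_mem_nhds h)).trans
    (Submodule.finrank_le _)

end Branches

/-- Here `n = 2 * k` is the dimension of the Fermat variety of degree `d` in `ℙ^{n+1}`. -/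
theorem theorem13 (k d : ℕ) (hd : 1 ≤ d)
    (a a' : Fin (k + 1) → Fin d) (b b' : Equiv.Perm (Fin (2 * k + 2)))
    (m : ℤ)
    (hm : (Module.finrank ℂ
      ↥((linearCycle a b).1 ⊓ (linearCycle a' b').1) : ℤ) = m + 1) :
    (∃ V, IsLocalBranch (linearCycle a b) (fermat (2 * k + 2) d) V) ∧
    (∃ V', IsLocalBranch (linearCycle a' b') (fermat (2 * k + 2) d) V') ∧
    ∀ V V' : Set (Form (2 * k + 2) d),
      IsLocalBranch (linearCycle a b) (fermat (2 * k + 2) d) V →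
      IsLocalBranch (linearCycle a' b') (fermat (2 * k + 2) d) V' →
      HasLocalCodim (V ∩ V') (fermat (2 * k + 2) d)
        (2 * cNumber (2 * k) d (onesThen d (k + 1) (k + 1)) -
          cNumber (2 * k) d (onesThen d (2 * k - m + 1).toNat (m + 1).toNat)) ∧
      ((linearCycle a b).1 ⊓ (linearCycle a' b').1 = ⊥ →
        TransverseAt V V' (fermat (2 * k + 2) d)) := by
  set q := Module.finrank ℂ ↥((linearCycle a b).1 ⊓ (linearCycle a' b').1) with hq
  have hq_le : q ≤ k + 1 := by
    rw [← (linearCycle a b).2]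
    exact Submodule.finrank_mono inf_le_left
  have hm1 : (m + 1).toNat = q := by omega
  have hm2 : (2 * k - m + 1).toNat + q = 2 * k + 2 := by omega
  rw [hm1]
  rcases Nat.lt_or_ge d 3 with hd3 | hd3
  · have hd2 : d ≤ 2 := by omega
    refine ⟨⟨_, isLocalBranch_linearCycle_univ hd hd2 a b⟩,
      ⟨_, isLocalBranch_linearCycle_univ hd hd2 a' b'⟩, fun V V' hV hV' => ?_⟩
    have hVn := hV.mem_nhds_fermat hd hd2
    have hVn' := hV'.mem_nhds_fermat hd hd2
    refine ⟨⟨_, hasLocalDim_of_mem_nhds (inter_mem hVn hVn'), ?_⟩, fun _ => ⟨⊤, ⊤,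
      isSubmanifoldAt_of_mem_nhds hVn, isSubmanifoldAt_of_mem_nhds hVn', sup_idem _⟩⟩
    rw [cNumber_onesThen_of_le_two (by omega) hd hd2, cNumber_onesThen_of_le_two hm2 hd hd2]
    ring
  · obtain ⟨u, hu, hr⟩ := exists_hasDisjointColumns_linearCycle a b
    obtain ⟨u', hu', hr'⟩ := exists_hasDisjointColumns_linearCycle a' b'
    obtain ⟨w, hw, hrw⟩ := exists_hasDisjointColumns_linearCycle_inf a a' b b'
    obtain ⟨V₀, hV₀, hT⟩ := exists_isLocalBranch_linearCycle hd3 hu hr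
    obtain ⟨V₀', hV₀', hT'⟩ := exists_isLocalBranch_linearCycle hd3 hu' hr'
    refine ⟨⟨_, hV₀⟩, ⟨_, hV₀'⟩, fun V V' hV hV' => ?_⟩
    replace hT := hT.congr (hV₀.unique hV)
    replace hT' := hT'.congr (hV₀'.unique hV')
    have hF := fermat_mem_vanishingForms (by omega) a b
    have hF' := fermat_mem_vanishingForms (by omega) a' b'
    have hinf : LinearMap.range w.toCLM.toLinearMap =
        LinearMap.range u.toCLM.toLinearMap ⊓ LinearMap.range u'.toCLM.toLinearMap := by
      rw [hrw, hr, hr']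
    obtain ⟨hsup, hfin⟩ := finrank_tangentForms_inf hd3 hu hu' hw hinf
    refine ⟨⟨_, ⟨?_, fun s hs => hs.le_finrank_inf hT hT'⟩, ?_⟩, fun hbot => ⟨_, _, hT, hT', ?_⟩⟩
    -- The lower bound on the dimension; the upper bound `le_finrank_inf` was supplied just above.
    · refine containsManifoldsNear_inter_of_isLocalBranch (by omega) hV hV' hF hF' hr.symm hr'.symm
        (Submodule.finrank_mono ?_)
      have := tangentForms_inf_le hd3 hu hu' hw (by omega) (by rwa [hr]) (by rwa [hr']) hinf
      rwa [hr, hr'] at this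
    · rw [hfin, Form.finrank_eq, cNumber_onesThen (by omega) hd3, cNumber_onesThen hm2 hd3]
      ring
    · rw [hsup, hw.tangentForms_eq_sup (by omega), hrw, hbot, eq_top_iff]
      -- Every form of positive degree vanishes on the zero subspace.
      refine le_sup_of_le_left fun c _ x hx => ?_
      rw [(Submodule.mem_bot ℂ).1 hx, Form.evalAt_zero (by omega)]
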